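/- Let $N\ge 1$, let $\Omega\subset\mathbb{R}^N$ be a bounded domain of class $C^1$, and let $a,b,c,d,\alpha,\beta,D_1,D_2,D_3,D_4$ be positive constants. Consider the four compartment Brusselator system $$\begin{aligned} u_t-a\Delta u&=\alpha-(\beta+1)u+u^2v+D_1(w-u),\\ v_t-b\Delta v&=\beta u-u^2v+D_2(z-v),\\ w_t-c\Delta w&=\alpha-(\beta+1)w+w^2z+D_3(u-w),\\ z_t-d\Delta z&=\beta w-w^2z+D_4(v-z) \end{aligned}$$ in $(0,T_{\max})\times\Omega$, with $u=v=w=z=0$ on $(0,T_{\max})\times\partial\Omega$ and nonnegative initial data $u_0,v_0,w_0,z_0\in L^\infty(\Omega)$. Let $(u,v,w,z)$ be a classical solution on $(0,T_{\max})\times\Omega$, where $0<T_{\max}\le\infty$ (in particular, $T_{\max}$ may be the maximal existence time): each component is of class $C^{1,2}$ in $(0,T_{\max})\times\Omega$, continuous on $(0,T_{\max})\times\overline\Omega$, bounded on $(0,s]\times\Omega$ for every $s<T_{\max}$, and converges to its initial datum in $L^1(\Omega)$ as $t\to0^+$. Then, for every integer $n\ge1$, $$u,\,v,\,w,\,z\in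 L^\infty\bigl(0,T_{\max};L^n(\Omega)\bigr).$$ -/

import Mathlib

open MeasureTheory Set Filter Topology
open scoped ENNReal

namespace Brusselator

/-- Euclidean space `ℝ^N`. -/
abbrev Space (N : ℕ) : Type := EuclideanSpace ℝ (Fin N)

/-- `Ω` is a bounded domain (non-empty, open, connected) of class `C¹` in `ℝ^N`: near every boundary
point it is the sublevel set `{Φ < 0}` of a `C¹` function `Φ` whose differential does not vanish. -/
structure IsBoundedC1Domain {N : ℕ} (Ω : Set (Space N)) : Prop where
  isOpen : IsOpen Ω
  isConnected : IsConnected Ω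
  isBounded : Bornology.IsBounded Ω
  boundary : ∀ x ∈ frontier Ω, ∃ (U : Set (Space N)) (Φ : Space N → ℝ),
    IsOpen U ∧ x ∈ U ∧ ContDiffOn ℝ 1 Φ U ∧ (∀ y ∈ U, fderiv ℝ Φ y ≠ 0) ∧
      Ω ∩ U = {y ∈ U | Φ y < 0}

/-- The open time interval `(0, T)`, where `T = ⊤` stands for `T = ∞`. -/
def timeInterval (T : EReal) : Set ℝ := {t : ℝ | 0 < t ∧ (t : EReal) < T}

/-- `u` is of class `C^{1,2}` on `(0, T) × Ω`: once differentiable in time, twice in space, with all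
these derivatives jointly continuous. -/
structure IsC12 {N : ℕ} (Ω : Set (Space N)) (T : EReal) (u : ℝ → Space N → ℝ) : Prop where
  differentiable_time : ∀ t ∈ timeInterval T, ∀ x ∈ Ω, DifferentiableAt ℝ (fun s => u s x) t
  continuous_deriv_time :
    ContinuousOn (fun q : ℝ × Space N => deriv (fun s => u s q.2) q.1) (timeInterval T ×ˢ Ω)
  contDiff_space : ∀ t ∈ timeInterval T, ContDiffOn ℝ 2 (u t) Ω
  continuous_fderiv_space :
    ContinuousOn (fun q : ℝ × Space N => fderiv ℝ (u q.1) q.2) (timeInterval T ×ˢ Ω)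
  continuous_iteratedFDeriv_space :
    ContinuousOn (fun q : ℝ × Space N => iteratedFDeriv ℝ 2 (u q.1) q.2) (timeInterval T ×ˢ Ω)

/-- The regularity, the boundary condition and the initial condition asked of one component `u` of a
classical solution on `(0, T) × Ω` with initial datum `u₀ ∈ L^∞(Ω)`. As `u₀` need not be continuous,
it is attained in the sense of bounded convergence in the mean: `u` is bounded on `(0, s] × Ω` for
every `s < T`, and `u(t) → u₀` in `L¹(Ω)` (equivalently, by the bound, in every `L^p(Ω)`, `p < ∞`)
as `t → 0+`. -/
structure IsClassicalComponent {N : ℕ} (Ω : Set (Space N)) (T : EReal) (u₀ : Space N → ℝ)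
    (u : ℝ → Space N → ℝ) : Prop where
  regular : IsC12 Ω T u
  continuous_closure :
    ContinuousOn (fun q : ℝ × Space N => u q.1 q.2) (timeInterval T ×ˢ closure Ω)
  dirichlet : ∀ t ∈ timeInterval T, ∀ x ∈ frontier Ω, u t x = 0
  locally_bounded : ∀ s ∈ timeInterval T, ∃ M : ℝ, ∀ t ∈ Ioc 0 s, ∀ x ∈ Ω, |u t x| ≤ M
  initial : Tendsto (fun t => eLpNorm (fun x => u t x - u₀ x) 1 (volume.restrict Ω))
    (𝓝[>] 0) (𝓝 0)

/-- `(u, v, w, z)` is a classical solution on `(0, T) × Ω` of the four compartment Brusselator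
system with homogeneous Dirichlet boundary conditions and initial data `(u₀, v₀, w₀, z₀)`. -/
structure IsSolution {N : ℕ} (Ω : Set (Space N)) (a b c d α β D₁ D₂ D₃ D₄ : ℝ)
    (u₀ v₀ w₀ z₀ : Space N → ℝ) (T : EReal) (u v w z : ℝ → Space N → ℝ) : Prop where
  comp_u : IsClassicalComponent Ω T u₀ u
  comp_v : IsClassicalComponent Ω T v₀ v
  comp_w : IsClassicalComponent Ω T w₀ w
  comp_z : IsClassicalComponent Ω T z₀ z
  eq_u : ∀ t ∈ timeInterval T, ∀ x ∈ Ω,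
    deriv (fun s => u s x) t - a * Laplacian.laplacian (u t) x =
      α - (β + 1) * u t x + u t x ^ 2 * v t x + D₁ * (w t x - u t x)
  eq_v : ∀ t ∈ timeInterval T, ∀ x ∈ Ω,
    deriv (fun s => v s x) t - b * Laplacian.laplacian (v t) x =
      β * u t x - u t x ^ 2 * v t x + D₂ * (z t x - v t x)
  eq_w : ∀ t ∈ timeInterval T, ∀ x ∈ Ω,
    deriv (fun s => w s x) t - c * Laplacian.laplacian (w t) x =
      α - (β + 1) * w t x + w t x ^ 2 * z t x + D₃ * (u t x - w t x)
  eq_z : ∀ t ∈ timeInterval T, ∀ x ∈ Ω,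
    deriv (fun s => z s x) t - d * Laplacian.laplacian (z t) x =
      β * w t x - w t x ^ 2 * z t x + D₄ * (v t x - z t x)

/-- `u ∈ L^∞(0, T; L^p(Ω))` (Bochner space): `t ↦ u(t)` agrees for almost every `t ∈ (0, T)` with a
strongly measurable, essentially bounded map into the Banach space `L^p(Ω)`. -/
def MemLinftyLp {N : ℕ} (Ω : Set (Space N)) (T : EReal) (p : ℝ≥0∞) [Fact (1 ≤ p)]
    (u : ℝ → Space N → ℝ) : Prop :=
  ∃ U : ℝ → Lp ℝ p ((volume : Measure (Space N)).restrict Ω),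
    MemLp U ∞ ((volume : Measure ℝ).restrict (timeInterval T)) ∧
      ∀ᵐ t ∂((volume : Measure ℝ).restrict (timeInterval T)),
        U t =ᵐ[(volume : Measure (Space N)).restrict Ω] u t

end Brusselator

/-! The proof is an energy argument resting on three facts.

Comparison. The reaction is quasi-positive, so nonnegative data give nonnegative solutions. The
inhibitors `v`, `z` are moreover bounded uniformly in time: completing the square gives `β u - u² v
≤ β² / (4 v)`, and comparison with a paraboloid `K (R - |x|²)` turns diffusion and the Dirichlet
condition into a sink that absorbs this quantity. Both follow from one maximum principle
(`nonpos_of_isSubsolution`), an `L¹` Gronwall estimate for positive parts, suited to data attained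
only in `L¹`.

Energy. In `u + v` the cubic term cancels and, `v` being bounded, what remains is damped linearly. A
power of `Y = u + v + A` alone fails, since for unequal diffusivities its Hessian form is
indefinite. The density `Y ^ (m + 4) + K Y ^ (m + 2) v²` repairs this: the second term adds `2 K Y ^
(m + 2)` to the `vv` entry, which dominates for large `K`, while a large `A` makes its other
contributions lower order because `v` is bounded (`lyapunov_dissipative`). In the reaction that term
meets `v (β u - u² v) ≤ β² / 4`, so it does no harm (`lyapunov_reaction_le`).

Coupling. Weighting the compartments by `D₃` and `D₁` symmetrizes the exchange, whose leading part
is then nonpositive by monotonicity of powers (`exists_lyapunov_production_le`). The weighted energy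
satisfies `F' ≤ C - F` in integrated form, hence is bounded on the whole interval and controls every
`L^n` norm.

Solutions are merely continuous up to the boundary, with no control of gradients there. Integration
by parts is therefore carried out after composing with smooth convex truncations that vanish below a
positive level; the integrands then have compact support in `Ω`, and the truncation is removed by
dominated convergence (`energy_le`). -/

namespace Brusselator

/-! ### A convex truncation of the positive part -/

/-- A `C¹` nondecreasing step, `0` on the negative axis and tending to `1` at `+∞`. -/
noncomputable def step (x : ℝ) : ℝ := max x 0 ^ 2 / (1 + x ^ 2)

/-- The derivative of `step`. -/
noncomputable def stepDeriv (x : ℝ) : ℝ := 2 * max x 0 / (1 + x ^ 2) ^ 2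

/-- The convex primitive of `step`. -/
noncomputable def ramp (x : ℝ) : ℝ := ∫ y in (0 : ℝ)..x, step y

lemma continuous_step : Continuous step := by
  unfold step
  exact Continuous.div (by fun_prop) (by fun_prop) fun x => by positivity

lemma continuous_stepDeriv : Continuous stepDeriv := by
  unfold stepDeriv
  exact Continuous.div (by fun_prop) (by fun_prop) fun x => by positivity

lemma hasDerivAt_posPart_sq (x : ℝ) : HasDerivAt (fun y : ℝ => max y 0 ^ 2) (2 * max x 0) x := by
  rcases lt_trichotomy x 0 with h | rfl | h
  · rw [max_eq_right h.le, mul_zero]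
    refine (hasDerivAt_const x (0 : ℝ)).congr_of_eventuallyEq ?_
    filter_upwards [Iio_mem_nhds h] with y hy
    simp [max_eq_right (mem_Iio.1 hy).le]
  · rw [hasDerivAt_iff_isLittleO]
    have h2 : (fun y : ℝ => y ^ 2) =o[𝓝 0] fun y : ℝ => y := by
      simpa using (Asymptotics.isLittleO_pow_pow (𝕜 := ℝ) (m := 1) (n := 2) (by norm_num))
    -- At the corner the squared positive part is dominated by `y²`, which is `o(y)`: this is why
    -- the step is built from a square.
    refine Asymptotics.IsBigO.trans_isLittleO (g := fun y : ℝ => y ^ 2) ?_ (by simpa using h2)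
    refine Asymptotics.IsBigO.of_bound 1 (Eventually.of_forall fun y => ?_)
    rcases le_total y 0 with hy | hy
    · simp [max_eq_right hy]
      positivity
    · simp [max_eq_left hy]
  · rw [max_eq_left h.le]
    have : HasDerivAt (fun y : ℝ => y ^ 2) (2 * x) x := by simpa using hasDerivAt_pow 2 x
    refine this.congr_of_eventuallyEq ?_
    filter_upwards [Ioi_mem_nhds h] with y hy
    simp [max_eq_left (mem_Ioi.1 hy).le]

lemma hasDerivAt_step (x : ℝ) : HasDerivAt step (stepDeriv x) x := by
  have h1 : HasDerivAt (fun y : ℝ => 1 + y ^ 2) (2 * x) x := by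
    simpa using (hasDerivAt_pow 2 x).const_add 1
  have h := (hasDerivAt_posPart_sq x).div h1 (by positivity)
  refine h.congr_deriv ?_
  unfold stepDeriv
  congr 1
  rcases le_total x 0 with hx | hx
  · simp [max_eq_right hx]
  · simp only [max_eq_left hx]; ring

lemma hasDerivAt_ramp (x : ℝ) : HasDerivAt ramp (step x) x :=
  intervalIntegral.integral_hasDerivAt_right (continuous_step.intervalIntegrable _ _)
    (continuous_step.stronglyMeasurableAtFilter _ _) continuous_step.continuousAt

lemma step_nonneg (x : ℝ) : 0 ≤ step x := by unfold step; positivity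

lemma stepDeriv_nonneg (x : ℝ) : 0 ≤ stepDeriv x := by unfold stepDeriv; positivity

lemma step_of_nonpos {x : ℝ} (hx : x ≤ 0) : step x = 0 := by simp [step, max_eq_right hx]

lemma step_le_one (x : ℝ) : step x ≤ 1 := by
  unfold step
  rw [div_le_one (by positivity)]
  rcases le_total x 0 with hx | hx
  · simp [max_eq_right hx]; positivity
  · simp [max_eq_left hx]

lemma ramp_of_nonpos {x : ℝ} (hx : x ≤ 0) : ramp x = 0 := by
  unfold ramp
  rw [intervalIntegral.integral_congr (g := fun _ => (0 : ℝ))]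
  · simp
  · intro y hy
    rw [uIcc_of_ge hx] at hy
    exact step_of_nonpos hy.2

lemma ramp_nonneg (x : ℝ) : 0 ≤ ramp x := by
  rcases le_total x 0 with hx | hx
  · rw [ramp_of_nonpos hx]
  · exact intervalIntegral.integral_nonneg hx fun y _ => step_nonneg y

lemma ramp_le {x : ℝ} (hx : 0 ≤ x) : ramp x ≤ x := by
  have := intervalIntegral.integral_mono_on (a := 0) (b := x) (μ := volume) hx
    (continuous_step.intervalIntegrable _ _) (continuous_const.intervalIntegrable _ _)
    fun y _ => step_le_one y
  simpa [ramp] using this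

/-- On the positive axis `1 - step y = 1 / (1 + y²)`, whose primitive is the arctangent. The defect
is thus bounded independently of `x`, and rescaling by `k + 1` sends it to zero. -/
lemma sub_ramp_le {x : ℝ} (hx : 0 ≤ x) : x - ramp x ≤ Real.pi / 2 := by
  have h : x - ramp x = ∫ y in (0 : ℝ)..x, (1 + y ^ 2)⁻¹ := by
    have h1 : x = ∫ y in (0 : ℝ)..x, (1 : ℝ) := by simp
    nth_rewrite 1 [h1]
    unfold ramp
    rw [← intervalIntegral.integral_sub (continuous_const.intervalIntegrable _ _)
      (continuous_step.intervalIntegrable _ _)]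
    refine intervalIntegral.integral_congr fun y hy => ?_
    rw [uIcc_of_le hx] at hy
    simp only [step, max_eq_left hy.1]
    field_simp
    ring
  rw [h, integral_inv_one_add_sq]
  simpa using (Real.arctan_lt_pi_div_two x).le

/-- `ramp` rescaled so as to approximate the positive part as `k → ∞`. -/
noncomputable def trunc (k : ℕ) (x : ℝ) : ℝ := ramp ((k + 1) * x - 1) / (k + 1)

/-- The derivative of `trunc k`. -/
noncomputable def truncDeriv (k : ℕ) (x : ℝ) : ℝ := step ((k + 1) * x - 1)

/-- The second derivative of `trunc k`. -/
noncomputable def truncDeriv₂ (k : ℕ) (x : ℝ) : ℝ := (k + 1) * stepDeriv ((k + 1) * x - 1)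

lemma hasDerivAt_trunc (k : ℕ) (x : ℝ) : HasDerivAt (trunc k) (truncDeriv k x) x := by
  have h1 : HasDerivAt (fun y : ℝ => ((k : ℝ) + 1) * y - 1) (k + 1) x := by
    simpa using ((hasDerivAt_id x).const_mul ((k : ℝ) + 1)).sub_const 1
  refine (((hasDerivAt_ramp _).comp x h1).div_const ((k : ℝ) + 1)).congr_deriv ?_
  unfold truncDeriv
  field_simp

lemma hasDerivAt_truncDeriv (k : ℕ) (x : ℝ) :
    HasDerivAt (truncDeriv k) (truncDeriv₂ k x) x := by
  have h1 : HasDerivAt (fun y : ℝ => ((k : ℝ) + 1) * y - 1) (k + 1) x := by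
    simpa using ((hasDerivAt_id x).const_mul ((k : ℝ) + 1)).sub_const 1
  refine ((hasDerivAt_step _).comp x h1).congr_deriv ?_
  unfold truncDeriv₂
  ring

lemma continuous_trunc (k : ℕ) : Continuous (trunc k) :=
  continuous_iff_continuousAt.2 fun x => (hasDerivAt_trunc k x).continuousAt

lemma continuous_truncDeriv (k : ℕ) : Continuous (truncDeriv k) :=
  continuous_iff_continuousAt.2 fun x => (hasDerivAt_truncDeriv k x).continuousAt

lemma continuous_truncDeriv₂ (k : ℕ) : Continuous (truncDeriv₂ k) := by
  unfold truncDeriv₂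
  exact continuous_const.mul (continuous_stepDeriv.comp (by fun_prop))

lemma trunc_nonneg (k : ℕ) (x : ℝ) : 0 ≤ trunc k x :=
  div_nonneg (ramp_nonneg _) (by positivity)

lemma truncDeriv_nonneg (k : ℕ) (x : ℝ) : 0 ≤ truncDeriv k x := step_nonneg _

lemma truncDeriv_le_one (k : ℕ) (x : ℝ) : truncDeriv k x ≤ 1 := step_le_one _

lemma truncDeriv₂_nonneg (k : ℕ) (x : ℝ) : 0 ≤ truncDeriv₂ k x :=
  mul_nonneg (by positivity) (stepDeriv_nonneg _)

lemma scaled_sub_one_nonpos {k : ℕ} {x : ℝ} (hx : x ≤ 1 / ((k : ℝ) + 1)) :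
    ((k : ℝ) + 1) * x - 1 ≤ 0 := by
  rw [le_div_iff₀ (by positivity)] at hx
  linarith

/-- The shift by `1` inside `trunc` serves this purpose: the truncation is flat up to a strictly
positive level, so for a function that is nonpositive on the boundary it acts only on a compact
subset of `Ω`. -/
lemma truncDeriv_of_le {k : ℕ} {x : ℝ} (hx : x ≤ 1 / ((k : ℝ) + 1)) : truncDeriv k x = 0 :=
  step_of_nonpos (scaled_sub_one_nonpos hx)

lemma trunc_le (k : ℕ) (x : ℝ) : trunc k x ≤ max x 0 := by
  unfold trunc
  have hk : (0 : ℝ) < k + 1 := by positivity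
  rcases le_total (((k : ℝ) + 1) * x - 1) 0 with h | h
  · rw [ramp_of_nonpos h]; simp
  · refine le_trans ?_ (le_max_left _ _)
    rw [div_le_iff₀ hk]
    linarith [ramp_le h]

lemma tendsto_trunc (x : ℝ) : Tendsto (fun k => trunc k x) atTop (𝓝 (max x 0)) := by
  have h0 : Tendsto (fun k : ℕ => 1 / ((k : ℝ) + 1)) atTop (𝓝 0) :=
    tendsto_one_div_add_atTop_nhds_zero_nat
  have h1 : Tendsto (fun k : ℕ => max x 0 - (1 + Real.pi / 2) * (1 / ((k : ℝ) + 1))) atTop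
      (𝓝 (max x 0)) := by
    simpa using (h0.const_mul (1 + Real.pi / 2)).const_sub (max x 0)
  refine tendsto_of_tendsto_of_tendsto_of_le_of_le h1 tendsto_const_nhds (fun k => ?_)
    fun k => trunc_le k x
  have hk : (0 : ℝ) < k + 1 := by positivity
  have hpi := Real.pi_pos
  show max x 0 - (1 + Real.pi / 2) * (1 / ((k : ℝ) + 1)) ≤ trunc k x
  unfold trunc
  rw [mul_one_div, sub_le_iff_le_add, ← add_div, le_div_iff₀ hk]
  rcases le_total (((k : ℝ) + 1) * x - 1) 0 with h | h
  · have : max x 0 * ((k : ℝ) + 1) ≤ 1 := by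
      rcases le_total x 0 with hx | hx
      · simp [max_eq_right hx]
      · rw [max_eq_left hx]; linarith
    linarith [ramp_nonneg (((k : ℝ) + 1) * x - 1)]
  · have hx : 0 ≤ x := by
      by_contra hx
      nlinarith
    rw [max_eq_left hx]
    linarith [sub_ramp_le h]

lemma tendsto_step_atTop : Tendsto step atTop (𝓝 1) := by
  have h : Tendsto (fun x : ℝ => 1 - (1 + x ^ 2)⁻¹) atTop (𝓝 (1 - 0)) := by
    refine tendsto_const_nhds.sub (tendsto_inv_atTop_zero.comp ?_)
    exact tendsto_atTop_add_const_left _ _ (tendsto_pow_atTop (by norm_num))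
  rw [sub_zero] at h
  refine h.congr' ?_
  filter_upwards [eventually_ge_atTop 0] with x hx
  simp only [step, max_eq_left hx]
  field_simp
  ring

lemma tendsto_truncDeriv (x : ℝ) :
    Tendsto (fun k => truncDeriv k x) atTop (𝓝 (if 0 < x then 1 else 0)) := by
  split_ifs with hx
  · refine tendsto_step_atTop.comp (tendsto_atTop_add_const_right _ (-1) ?_)
    refine Tendsto.atTop_mul_const hx ?_
    exact tendsto_atTop_add_const_right _ _ tendsto_natCast_atTop_atTop
  · refine tendsto_const_nhds.congr fun k => ?_
    rw [truncDeriv_of_le]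
    exact (not_lt.1 hx).trans (by positivity)

/-! ### Functions of two variables given with their partial derivatives -/

/-- `Hr` and `Hs` are the partial derivatives of the differentiable function `H` of two variables,
expressed through the chain rule along curves. -/
def HasPartials (H Hr Hs : ℝ → ℝ → ℝ) : Prop :=
  ∀ (p q : ℝ → ℝ) (p' q' t : ℝ), HasDerivAt p p' t → HasDerivAt q q' t →
    HasDerivAt (fun τ => H (p τ) (q τ)) (Hr (p t) (q t) * p' + Hs (p t) (q t) * q') t

/-- A `C²` function of two variables together with its derivatives up to order two. -/
structure Density where
  H : ℝ → ℝ → ℝ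
  Hr : ℝ → ℝ → ℝ
  Hs : ℝ → ℝ → ℝ
  Hrr : ℝ → ℝ → ℝ
  Hrs : ℝ → ℝ → ℝ
  Hss : ℝ → ℝ → ℝ
  partials : HasPartials H Hr Hs
  partials_r : HasPartials Hr Hrr Hrs
  partials_s : HasPartials Hs Hrs Hss
  continuous_H : Continuous fun p : ℝ × ℝ => H p.1 p.2
  continuous_Hr : Continuous fun p : ℝ × ℝ => Hr p.1 p.2
  continuous_Hs : Continuous fun p : ℝ × ℝ => Hs p.1 p.2
  continuous_Hrr : Continuous fun p : ℝ × ℝ => Hrr p.1 p.2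
  continuous_Hrs : Continuous fun p : ℝ × ℝ => Hrs p.1 p.2
  continuous_Hss : Continuous fun p : ℝ × ℝ => Hss p.1 p.2

/-- The density `H(r, s) = r`. -/
def Density.fst : Density where
  H r _ := r
  Hr _ _ := 1
  Hs _ _ := 0
  Hrr _ _ := 0
  Hrs _ _ := 0
  Hss _ _ := 0
  partials := fun p q p' q' t hp hq => by simpa using hp
  partials_r := fun p q p' q' t hp hq => by simpa using hasDerivAt_const t (1 : ℝ)
  partials_s := fun p q p' q' t hp hq => by simpa using hasDerivAt_const t (0 : ℝ)
  continuous_H := continuous_fst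
  continuous_Hr := continuous_const
  continuous_Hs := continuous_const
  continuous_Hrr := continuous_const
  continuous_Hrs := continuous_const
  continuous_Hss := continuous_const

/-- The density `H(η(r), η(s))`, where `η = trunc k`. -/
noncomputable def Density.truncate (D : Density) (k : ℕ) : Density where
  H r s := D.H (trunc k r) (trunc k s)
  Hr r s := D.Hr (trunc k r) (trunc k s) * truncDeriv k r
  Hs r s := D.Hs (trunc k r) (trunc k s) * truncDeriv k s
  Hrr r s := D.Hrr (trunc k r) (trunc k s) * truncDeriv k r ^ 2 +
    D.Hr (trunc k r) (trunc k s) * truncDeriv₂ k r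
  Hrs r s := D.Hrs (trunc k r) (trunc k s) * truncDeriv k r * truncDeriv k s
  Hss r s := D.Hss (trunc k r) (trunc k s) * truncDeriv k s ^ 2 +
    D.Hs (trunc k r) (trunc k s) * truncDeriv₂ k s
  partials := fun p q p' q' t hp hq => by
    have h := D.partials _ _ _ _ t ((hasDerivAt_trunc k _).comp t hp)
      ((hasDerivAt_trunc k _).comp t hq)
    refine h.congr_deriv ?_
    simp only [Function.comp_apply]; ring
  partials_r := fun p q p' q' t hp hq => by
    have h := D.partials_r _ _ _ _ t ((hasDerivAt_trunc k _).comp t hp)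
      ((hasDerivAt_trunc k _).comp t hq)
    refine (h.mul ((hasDerivAt_truncDeriv k _).comp t hp)).congr_deriv ?_
    simp only [Function.comp_apply]; ring
  partials_s := fun p q p' q' t hp hq => by
    have h := D.partials_s _ _ _ _ t ((hasDerivAt_trunc k _).comp t hp)
      ((hasDerivAt_trunc k _).comp t hq)
    refine (h.mul ((hasDerivAt_truncDeriv k _).comp t hq)).congr_deriv ?_
    simp only [Function.comp_apply]; ring
  continuous_H := D.continuous_H.comp (((continuous_trunc k).comp continuous_fst).prodMk
    ((continuous_trunc k).comp continuous_snd))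
  continuous_Hr := (D.continuous_Hr.comp (((continuous_trunc k).comp continuous_fst).prodMk
    ((continuous_trunc k).comp continuous_snd))).mul ((continuous_truncDeriv k).comp continuous_fst)
  continuous_Hs := (D.continuous_Hs.comp (((continuous_trunc k).comp continuous_fst).prodMk
    ((continuous_trunc k).comp continuous_snd))).mul ((continuous_truncDeriv k).comp continuous_snd)
  continuous_Hrr := ((D.continuous_Hrr.comp (((continuous_trunc k).comp continuous_fst).prodMk
    ((continuous_trunc k).comp continuous_snd))).mul
      (((continuous_truncDeriv k).comp continuous_fst).pow 2)).add
    ((D.continuous_Hr.comp (((continuous_trunc k).comp continuous_fst).prodMk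
    ((continuous_trunc k).comp continuous_snd))).mul ((continuous_truncDeriv₂ k).comp continuous_fst))
  continuous_Hrs := ((D.continuous_Hrs.comp (((continuous_trunc k).comp continuous_fst).prodMk
    ((continuous_trunc k).comp continuous_snd))).mul
      ((continuous_truncDeriv k).comp continuous_fst)).mul
      ((continuous_truncDeriv k).comp continuous_snd)
  continuous_Hss := ((D.continuous_Hss.comp (((continuous_trunc k).comp continuous_fst).prodMk
    ((continuous_trunc k).comp continuous_snd))).mul
      (((continuous_truncDeriv k).comp continuous_snd).pow 2)).add
    ((D.continuous_Hs.comp (((continuous_trunc k).comp continuous_fst).prodMk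
    ((continuous_trunc k).comp continuous_snd))).mul ((continuous_truncDeriv₂ k).comp continuous_snd))

/-- At `(r, s)` the density is nondecreasing in both variables and the cross-diffusion form with
diffusivities `a`, `b` is positive semidefinite. -/
structure Density.Dissipative (D : Density) (a b r s : ℝ) : Prop where
  Hr_nonneg : 0 ≤ D.Hr r s
  Hs_nonneg : 0 ≤ D.Hs r s
  form_nonneg : ∀ ξ ζ : ℝ,
    0 ≤ a * D.Hrr r s * ξ ^ 2 + (a + b) * D.Hrs r s * (ξ * ζ) + b * D.Hss r s * ζ ^ 2

/-- The chain rule gives the form of `D` at the vector `(η'(r) ξ, η'(s) ζ)` plus the terms `a H_r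
η''(r) ξ²` and `b H_s η''(s) ζ²`. These are nonnegative because `η` is convex and `D` is
nondecreasing in both variables. -/
lemma Density.Dissipative.truncate {D : Density} {a b r s : ℝ} {k : ℕ} (ha : 0 ≤ a) (hb : 0 ≤ b)
    (h : D.Dissipative a b (trunc k r) (trunc k s)) : (D.truncate k).Dissipative a b r s where
  Hr_nonneg := mul_nonneg h.Hr_nonneg (truncDeriv_nonneg _ _)
  Hs_nonneg := mul_nonneg h.Hs_nonneg (truncDeriv_nonneg _ _)
  form_nonneg ξ ζ := by
    have h1 := h.form_nonneg (truncDeriv k r * ξ) (truncDeriv k s * ζ)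
    have h2 : 0 ≤ a * (D.Hr (trunc k r) (trunc k s) * truncDeriv₂ k r) * ξ ^ 2 :=
      mul_nonneg (mul_nonneg ha (mul_nonneg h.Hr_nonneg (truncDeriv₂_nonneg _ _))) (sq_nonneg _)
    have h3 : 0 ≤ b * (D.Hs (trunc k r) (trunc k s) * truncDeriv₂ k s) * ζ ^ 2 :=
      mul_nonneg (mul_nonneg hb (mul_nonneg h.Hs_nonneg (truncDeriv₂_nonneg _ _))) (sq_nonneg _)
    simp only [Density.truncate]
    linarith


/-! ### Compactly supported integrands -/

section
variable {X : Type*} [TopologicalSpace X] [T2Space X] [MeasurableSpace X] [OpensMeasurableSpace X]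
  {μ : Measure X} [IsFiniteMeasureOnCompacts μ]

lemma integrable_of_eq_zero_off_compact {K : Set X} (hK : IsCompact K) {F : X → ℝ}
    (hF : ContinuousOn F K) (h0 : ∀ x ∉ K, F x = 0) : Integrable F μ := by
  have h1 : IntegrableOn F K μ := hF.integrableOn_compact hK
  rw [← integrable_indicator_iff hK.measurableSet] at h1
  refine h1.congr (Eventually.of_forall fun x => ?_)
  by_cases hx : x ∈ K
  · rw [indicator_of_mem hx]
  · rw [indicator_of_notMem hx, h0 x hx]

lemma integrableOn_of_eq_zero_off_compact {K S : Set X} (hK : IsCompact K) (hKS : K ⊆ S)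
    (hS : MeasurableSet S) {F : X → ℝ} (hF : ContinuousOn F K) (h0 : ∀ x ∈ S \ K, F x = 0) :
    IntegrableOn F S μ := by
  rw [← integrable_indicator_iff hS]
  refine integrable_of_eq_zero_off_compact hK ?_ fun x hx => ?_
  · exact hF.congr fun x hx => indicator_of_mem (hKS hx) _
  · by_cases hxS : x ∈ S
    · rw [indicator_of_mem hxS, h0 x ⟨hxS, hx⟩]
    · rw [indicator_of_notMem hxS]
end

/-! ### Integration of the diffusion terms -/

/-- Integration by parts against the constant function `1`. -/
lemma integral_lineDeriv_eq_zero {N : ℕ} {F F' : Space N → ℝ} {e : Space N}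
    (hF : Integrable F) (hF' : Integrable F') (h : ∀ x, HasLineDerivAt ℝ F (F' x) x e) :
    ∫ x, F' x = 0 := by
  have := integral_bilinear_hasLineDerivAt_right_eq_neg_left_of_integrable
    (μ := (volume : Measure (Space N))) (f := F) (f' := F') (g := fun _ => (1 : ℝ))
    (g' := fun _ => (0 : ℝ)) (v := e) (B := ContinuousLinearMap.mul ℝ ℝ)
    (by simpa using hF') (by simp) (by simpa using hF) (fun x _ => h x)
    (fun x _ => by
      unfold HasLineDerivAt
      exact hasDerivAt_const _ _)
  simpa using this

lemma hasLineDerivAt_fderiv_apply {N : ℕ} {U : Space N → ℝ} {x : Space N} (hU : ContDiffAt ℝ 2 U x)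
    (e : Space N) :
    HasLineDerivAt ℝ (fun y => fderiv ℝ U y e) (fderiv ℝ (fderiv ℝ U) x e e) x e := by
  have h : DifferentiableAt ℝ (fderiv ℝ U) x :=
    (hU.fderiv_right (m := 1) (by norm_num)).differentiableAt (by norm_num)
  exact (h.hasFDerivAt.clm_apply (hasFDerivAt_const e x)).hasLineDerivAt e |>.congr_deriv (by simp)

lemma continuousOn_fderiv_fderiv_apply {N : ℕ} {Ω : Set (Space N)} (hΩ : IsOpen Ω)
    {U : Space N → ℝ} (hU : ContDiffOn ℝ 2 U Ω) (e : Space N) :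
    ContinuousOn (fun x => fderiv ℝ (fderiv ℝ U) x e e) Ω := by
  have h1 : ContDiffOn ℝ 1 (fderiv ℝ U) Ω := hU.fderiv_of_isOpen hΩ (by norm_num)
  have h2 : ContinuousOn (fderiv ℝ (fderiv ℝ U)) Ω :=
    h1.continuousOn_fderiv_of_isOpen hΩ (by norm_num)
  exact (h2.clm_apply continuousOn_const).clm_apply continuousOn_const

lemma laplacian_eq_sum {N : ℕ} (U : Space N → ℝ) (x : Space N) :
    Laplacian.laplacian U x = ∑ i, fderiv ℝ (fderiv ℝ U) x
      (EuclideanSpace.basisFun (Fin N) ℝ i) (EuclideanSpace.basisFun (Fin N) ℝ i) := by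
  rw [InnerProductSpace.laplacian_eq_iteratedFDeriv_orthonormalBasis U
    (EuclideanSpace.basisFun (Fin N) ℝ)]
  simp [iteratedFDeriv_two_apply]

lemma continuousOn_laplacian {N : ℕ} {Ω : Set (Space N)} (hΩ : IsOpen Ω)
    {U : Space N → ℝ} (hU : ContDiffOn ℝ 2 U Ω) : ContinuousOn (Laplacian.laplacian U) Ω := by
  have : ContinuousOn (fun x => ∑ i, fderiv ℝ (fderiv ℝ U) x
      (EuclideanSpace.basisFun (Fin N) ℝ i) (EuclideanSpace.basisFun (Fin N) ℝ i)) Ω :=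
    continuousOn_finsetSum _ fun i _ => continuousOn_fderiv_fderiv_apply hΩ hU _
  exact this.congr fun x _ => laplacian_eq_sum U x

section
variable {N : ℕ} {Ω K : Set (Space N)} {U V : Space N → ℝ} {G : Density} {a b : ℝ}

/-- The field `a H_r ∂ₑU + b H_s ∂ₑV`, extended by zero, is differentiable along `e` on the whole
space, so its derivative integrates to zero. That derivative is the diffusion integrand plus the
dissipation form at `(∂ₑU, ∂ₑV)`, which is nonnegative. Working one direction at a time keeps the
form scalar. -/
lemma integral_directional_diffusion_nonpos (hΩ : IsOpen Ω) (hK : IsCompact K) (hKΩ : K ⊆ Ω)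
    (hU : ContDiffOn ℝ 2 U Ω) (hV : ContDiffOn ℝ 2 V Ω)
    (hr : ∀ x ∈ Ω \ K, G.Hr (U x) (V x) = 0) (hs : ∀ x ∈ Ω \ K, G.Hs (U x) (V x) = 0)
    (hG : ∀ x ∈ Ω, G.Dissipative a b (U x) (V x)) (e : Space N) :
    IntegrableOn (fun x => a * G.Hr (U x) (V x) * fderiv ℝ (fderiv ℝ U) x e e +
      b * G.Hs (U x) (V x) * fderiv ℝ (fderiv ℝ V) x e e) Ω ∧
    ∫ x in Ω, (a * G.Hr (U x) (V x) * fderiv ℝ (fderiv ℝ U) x e e +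
      b * G.Hs (U x) (V x) * fderiv ℝ (fderiv ℝ V) x e e) ≤ 0 := by
  have hUV : ContinuousOn (fun x => (U x, V x)) Ω := hU.continuousOn.prodMk hV.continuousOn
  have cU1 : ContinuousOn (fun x => fderiv ℝ U x e) Ω :=
    (hU.continuousOn_fderiv_of_isOpen hΩ (by norm_num)).clm_apply continuousOn_const
  have cV1 : ContinuousOn (fun x => fderiv ℝ V x e) Ω :=
    (hV.continuousOn_fderiv_of_isOpen hΩ (by norm_num)).clm_apply continuousOn_const
  have cU2 := continuousOn_fderiv_fderiv_apply hΩ hU e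
  have cV2 := continuousOn_fderiv_fderiv_apply hΩ hV e
  have cr : ContinuousOn (fun x => G.Hr (U x) (V x)) Ω := G.continuous_Hr.comp_continuousOn hUV
  have cs : ContinuousOn (fun x => G.Hs (U x) (V x)) Ω := G.continuous_Hs.comp_continuousOn hUV
  have crr : ContinuousOn (fun x => G.Hrr (U x) (V x)) Ω := G.continuous_Hrr.comp_continuousOn hUV
  have crs : ContinuousOn (fun x => G.Hrs (U x) (V x)) Ω := G.continuous_Hrs.comp_continuousOn hUV
  have css : ContinuousOn (fun x => G.Hss (U x) (V x)) Ω := G.continuous_Hss.comp_continuousOn hUV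
  set F : Space N → ℝ := fun x =>
    a * G.Hr (U x) (V x) * fderiv ℝ U x e + b * G.Hs (U x) (V x) * fderiv ℝ V x e with hFdef
  set L : Space N → ℝ := fun x => a * G.Hr (U x) (V x) * fderiv ℝ (fderiv ℝ U) x e e +
      b * G.Hs (U x) (V x) * fderiv ℝ (fderiv ℝ V) x e e with hLdef
  set F' : Space N → ℝ := fun x => L x + (a * G.Hrr (U x) (V x) * (fderiv ℝ U x e) ^ 2 +
    (a + b) * G.Hrs (U x) (V x) * (fderiv ℝ U x e * fderiv ℝ V x e) +
    b * G.Hss (U x) (V x) * (fderiv ℝ V x e) ^ 2) with hF'def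
  have cF : ContinuousOn F Ω := by fun_prop
  have cL : ContinuousOn L Ω := by fun_prop
  have cF' : ContinuousOn F' Ω := by fun_prop
  have hderiv : ∀ x ∈ Ω, HasLineDerivAt ℝ F (F' x) x e := by
    intro x hx
    have hUx := hU.contDiffAt (hΩ.mem_nhds hx)
    have hVx := hV.contDiffAt (hΩ.mem_nhds hx)
    have dU : HasDerivAt (fun τ : ℝ => U (x + τ • e)) (fderiv ℝ U x e) 0 :=
      (hUx.differentiableAt (by norm_num)).hasFDerivAt.hasLineDerivAt e
    have dV : HasDerivAt (fun τ : ℝ => V (x + τ • e)) (fderiv ℝ V x e) 0 :=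
      (hVx.differentiableAt (by norm_num)).hasFDerivAt.hasLineDerivAt e
    have dU1 : HasDerivAt (fun τ : ℝ => fderiv ℝ U (x + τ • e) e) _ 0 :=
      hasLineDerivAt_fderiv_apply hUx e
    have dV1 : HasDerivAt (fun τ : ℝ => fderiv ℝ V (x + τ • e) e) _ 0 :=
      hasLineDerivAt_fderiv_apply hVx e
    have h := (((G.partials_r _ _ _ _ 0 dU dV).const_mul a).mul dU1).add
      (((G.partials_s _ _ _ _ 0 dU dV).const_mul b).mul dV1)
    refine HasDerivAt.congr_deriv h ?_
    simp only [zero_smul, add_zero, hF'def, hLdef]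
    ring
  have hF0 : ∀ x ∈ Ω \ K, F x = 0 := fun x hx => by simp [hFdef, hr x hx, hs x hx]
  have hL0 : ∀ x ∈ Ω \ K, L x = 0 := fun x hx => by simp [hLdef, hr x hx, hs x hx]
  have hind : ∀ x ∉ K, indicator Ω F =ᶠ[𝓝 x] fun _ => 0 := by
    intro x hx
    filter_upwards [hK.isClosed.isOpen_compl.mem_nhds hx] with y hy
    by_cases hyΩ : y ∈ Ω
    · rw [indicator_of_mem hyΩ, hF0 y ⟨hyΩ, hy⟩]
    · rw [indicator_of_notMem hyΩ]
  have hzero : ∀ x ∉ K, HasLineDerivAt ℝ (indicator Ω F) 0 x e := fun x hx =>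
    HasLineDerivAt.congr_of_eventuallyEq (by
      unfold HasLineDerivAt
      exact hasDerivAt_const _ _) (hind x hx)
  have hline : ∀ x ∈ Ω, HasLineDerivAt ℝ (indicator Ω F) (F' x) x e := fun x hx =>
    HasLineDerivAt.congr_of_eventuallyEq (hderiv x hx) (by
      filter_upwards [hΩ.mem_nhds hx] with y hy
      rw [indicator_of_mem hy])
  -- No formula for the second derivatives of `G` off `K` is needed: the extended field vanishes
  -- near such points, so uniqueness of the derivative gives the claim.
  have hF'0 : ∀ x ∈ Ω \ K, F' x = 0 := fun x hx =>
    HasDerivAt.unique (hline x hx.1) (hzero x hx.2)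
  have iF : IntegrableOn F Ω :=
    integrableOn_of_eq_zero_off_compact hK hKΩ hΩ.measurableSet (cF.mono hKΩ) hF0
  have iL : IntegrableOn L Ω :=
    integrableOn_of_eq_zero_off_compact hK hKΩ hΩ.measurableSet (cL.mono hKΩ) hL0
  have iF' : IntegrableOn F' Ω :=
    integrableOn_of_eq_zero_off_compact hK hKΩ hΩ.measurableSet (cF'.mono hKΩ) hF'0
  refine ⟨iL, ?_⟩
  have hint : ∫ x in Ω, F' x = 0 := by
    rw [← integral_indicator hΩ.measurableSet]
    refine integral_lineDeriv_eq_zero (F := indicator Ω F) (e := e)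
      ((integrable_indicator_iff hΩ.measurableSet).2 iF)
      ((integrable_indicator_iff hΩ.measurableSet).2 iF') fun x => ?_
    by_cases hx : x ∈ Ω
    · rw [indicator_of_mem hx]; exact hline x hx
    · rw [indicator_of_notMem hx]; exact hzero x fun h => hx (hKΩ h)
  rw [← hint]
  refine setIntegral_mono_on iL iF' hΩ.measurableSet fun x hx => ?_
  have := (hG x hx).form_nonneg (fderiv ℝ U x e) (fderiv ℝ V x e)
  simp only [hF'def]
  linarith

lemma integral_diffusion_nonpos (hΩ : IsOpen Ω) (hK : IsCompact K) (hKΩ : K ⊆ Ω)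
    (hU : ContDiffOn ℝ 2 U Ω) (hV : ContDiffOn ℝ 2 V Ω)
    (hr : ∀ x ∈ Ω \ K, G.Hr (U x) (V x) = 0) (hs : ∀ x ∈ Ω \ K, G.Hs (U x) (V x) = 0)
    (hG : ∀ x ∈ Ω, G.Dissipative a b (U x) (V x)) :
    ∫ x in Ω, (G.Hr (U x) (V x) * (a * Laplacian.laplacian U x) +
      G.Hs (U x) (V x) * (b * Laplacian.laplacian V x)) ≤ 0 := by
  have h := fun i => integral_directional_diffusion_nonpos hΩ hK hKΩ hU hV hr hs hG
    (EuclideanSpace.basisFun (Fin N) ℝ i)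
  calc _ = ∫ x in Ω, ∑ i, (a * G.Hr (U x) (V x) * fderiv ℝ (fderiv ℝ U) x
        (EuclideanSpace.basisFun (Fin N) ℝ i) (EuclideanSpace.basisFun (Fin N) ℝ i) +
        b * G.Hs (U x) (V x) * fderiv ℝ (fderiv ℝ V) x
        (EuclideanSpace.basisFun (Fin N) ℝ i) (EuclideanSpace.basisFun (Fin N) ℝ i)) := by
        refine integral_congr_ae (Eventually.of_forall fun x => ?_)
        simp only [laplacian_eq_sum, Finset.sum_add_distrib, ← Finset.mul_sum]
        ring
    _ = ∑ i, _ := integral_finsetSum _ fun i _ => (h i).1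
    _ ≤ 0 := Finset.sum_nonpos fun i _ => (h i).2
end


/-! ### Subsolutions and the energy inequality -/

/-- `q` is a regular subsolution of `∂ₜ q - κ Δ q ≤ f` on `J × Ω`, nonpositive on the lateral
boundary, with a source that is continuous up to the boundary. -/
structure IsSubsolution {N : ℕ} (Ω : Set (Space N)) (J : Set ℝ) (κ : ℝ)
    (q f : ℝ → Space N → ℝ) : Prop where
  differentiable_time : ∀ t ∈ J, ∀ x ∈ Ω, DifferentiableAt ℝ (fun s => q s x) t
  continuous_deriv_time :
    ContinuousOn (fun p : ℝ × Space N => deriv (fun s => q s p.2) p.1) (J ×ˢ Ω)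
  contDiff_space : ∀ t ∈ J, ContDiffOn ℝ 2 (q t) Ω
  continuous_closure : ContinuousOn (fun p : ℝ × Space N => q p.1 p.2) (J ×ˢ closure Ω)
  boundary : ∀ t ∈ J, ∀ x ∈ frontier Ω, q t x ≤ 0
  continuous_source : ContinuousOn (fun p : ℝ × Space N => f p.1 p.2) (J ×ˢ closure Ω)
  le : ∀ t ∈ J, ∀ x ∈ Ω, deriv (fun s => q s x) t ≤ κ * Laplacian.laplacian (q t) x + f t x

section
variable {N : ℕ} {Ω : Set (Space N)} {J : Set ℝ}

lemma IsSubsolution.mono {J' : Set ℝ} {κ : ℝ} {q f : ℝ → Space N → ℝ}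
    (h : IsSubsolution Ω J κ q f) (hJ : J' ⊆ J) : IsSubsolution Ω J' κ q f where
  differentiable_time t ht := h.differentiable_time t (hJ ht)
  continuous_deriv_time := h.continuous_deriv_time.mono (prod_mono_left hJ)
  contDiff_space t ht := h.contDiff_space t (hJ ht)
  continuous_closure := h.continuous_closure.mono (prod_mono_left hJ)
  boundary t ht := h.boundary t (hJ ht)
  continuous_source := h.continuous_source.mono (prod_mono_left hJ)
  le t ht := h.le t (hJ ht)

lemma continuousOn_slice {f : ℝ → Space N → ℝ} {S : Set (Space N)}
    (hf : ContinuousOn (fun p : ℝ × Space N => f p.1 p.2) (J ×ˢ S)) {t : ℝ} (ht : t ∈ J) :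
    ContinuousOn (f t) S :=
  hf.comp (f := fun x => (t, x)) (by fun_prop) fun _ hx => ⟨ht, hx⟩

lemma continuousOn_time_slice {f : ℝ → Space N → ℝ} {S : Set (Space N)}
    (hf : ContinuousOn (fun p : ℝ × Space N => f p.1 p.2) (J ×ˢ S)) {x : Space N} (hx : x ∈ S) :
    ContinuousOn (fun t => f t x) J :=
  hf.comp (f := fun t => (t, x)) (by fun_prop) fun _ ht => ⟨ht, hx⟩

lemma integrableOn_of_continuousOn_closure (hb : Bornology.IsBounded Ω) {f : Space N → ℝ}
    (hf : ContinuousOn f (closure Ω)) : IntegrableOn f Ω :=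
  (hf.integrableOn_compact hb.isCompact_closure).mono_set subset_closure

lemma integrableOn_prod_of_continuousOn_closure (hb : Bornology.IsBounded Ω) {t₀ t₁ : ℝ}
    {f : ℝ → Space N → ℝ}
    (hf : ContinuousOn (fun p : ℝ × Space N => f p.1 p.2) (Icc t₀ t₁ ×ˢ closure Ω)) :
    IntegrableOn (fun p : ℝ × Space N => f p.1 p.2) (Ioc t₀ t₁ ×ˢ Ω) :=
  (hf.integrableOn_compact (isCompact_Icc.prod hb.isCompact_closure)).mono_set
    (prod_mono Ioc_subset_Icc_self subset_closure)

lemma setIntegral_prod_Ioc {t₀ t₁ : ℝ} {f : ℝ → Space N → ℝ}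
    (hf : IntegrableOn (fun p : ℝ × Space N => f p.1 p.2) (Ioc t₀ t₁ ×ˢ Ω)) :
    ∫ p in Ioc t₀ t₁ ×ˢ Ω, f p.1 p.2 = ∫ s in Ioc t₀ t₁, ∫ x in Ω, f s x := by
  rw [Measure.volume_eq_prod] at hf ⊢
  exact setIntegral_prod _ hf

/-- The region where one of two functions exceeds a positive level stays in a compact subset of
`Ω` if both are nonpositive on the boundary. -/
lemma exists_compact_superlevel (hΩ : IsOpen Ω) (hb : Bornology.IsBounded Ω) {t₀ t₁ δ : ℝ}
    (hδ : 0 < δ) {q₁ q₂ : ℝ → Space N → ℝ}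
    (h₁ : ContinuousOn (fun p : ℝ × Space N => q₁ p.1 p.2) (Icc t₀ t₁ ×ˢ closure Ω))
    (h₂ : ContinuousOn (fun p : ℝ × Space N => q₂ p.1 p.2) (Icc t₀ t₁ ×ˢ closure Ω))
    (hb₁ : ∀ t ∈ Icc t₀ t₁, ∀ x ∈ frontier Ω, q₁ t x ≤ 0)
    (hb₂ : ∀ t ∈ Icc t₀ t₁, ∀ x ∈ frontier Ω, q₂ t x ≤ 0) :
    ∃ K : Set (Space N), IsCompact K ∧ K ⊆ Ω ∧
      ∀ t ∈ Icc t₀ t₁, ∀ x ∈ Ω \ K, q₁ t x ≤ δ ∧ q₂ t x ≤ δ := by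
  have hC : IsCompact (Icc t₀ t₁ ×ˢ closure Ω) := isCompact_Icc.prod hb.isCompact_closure
  set m : ℝ × Space N → ℝ := fun p => max (q₁ p.1 p.2) (q₂ p.1 p.2) with hm
  have hmc : ContinuousOn m (Icc t₀ t₁ ×ˢ closure Ω) :=
    continuous_max.comp_continuousOn (h₁.prodMk h₂)
  have hclosed : IsClosed ((Icc t₀ t₁ ×ˢ closure Ω) ∩ m ⁻¹' Ici δ) :=
    hmc.preimage_isClosed_of_isClosed hC.isClosed isClosed_Ici
  have hcomp : IsCompact ((Icc t₀ t₁ ×ˢ closure Ω) ∩ m ⁻¹' Ici δ) :=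
    hC.of_isClosed_subset hclosed inter_subset_left
  refine ⟨Prod.snd '' ((Icc t₀ t₁ ×ˢ closure Ω) ∩ m ⁻¹' Ici δ), hcomp.image continuous_snd, ?_, ?_⟩
  · rintro _ ⟨⟨t, x⟩, ⟨⟨ht, hx⟩, hδm⟩, rfl⟩
    by_contra hxΩ
    have hxf : x ∈ frontier Ω := by
      rw [hΩ.frontier_eq]
      exact ⟨hx, hxΩ⟩
    have : m (t, x) ≤ 0 := max_le (hb₁ t ht x hxf) (hb₂ t ht x hxf)
    have h2 : δ ≤ m (t, x) := hδm
    linarith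
  · intro t ht x hx
    have : m (t, x) < δ := by
      by_contra h
      exact hx.2 ⟨(t, x), ⟨⟨ht, subset_closure hx.1⟩, not_lt.1 h⟩, rfl⟩
    exact max_le_iff.1 this.le

/-- The energy inequality for a density whose gradient vanishes near the boundary. -/
lemma energy_le_of_eq_zero_off_compact (hΩ : IsOpen Ω) (hb : Bornology.IsBounded Ω) {t₀ t₁ : ℝ}
    (h01 : t₀ ≤ t₁) {a b : ℝ} {q₁ q₂ f g : ℝ → Space N → ℝ} {G : Density}
    (h₁ : IsSubsolution Ω (Icc t₀ t₁) a q₁ f) (h₂ : IsSubsolution Ω (Icc t₀ t₁) b q₂ g)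
    {K : Set (Space N)} (hK : IsCompact K) (hKΩ : K ⊆ Ω)
    (hr : ∀ t ∈ Icc t₀ t₁, ∀ x ∈ Ω \ K, G.Hr (q₁ t x) (q₂ t x) = 0)
    (hs : ∀ t ∈ Icc t₀ t₁, ∀ x ∈ Ω \ K, G.Hs (q₁ t x) (q₂ t x) = 0)
    (hG : ∀ t ∈ Icc t₀ t₁, ∀ x ∈ Ω, G.Dissipative a b (q₁ t x) (q₂ t x)) :
    (∫ x in Ω, G.H (q₁ t₁ x) (q₂ t₁ x)) - ∫ x in Ω, G.H (q₁ t₀ x) (q₂ t₀ x) ≤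
      ∫ p in Ioc t₀ t₁ ×ˢ Ω, (G.Hr (q₁ p.1 p.2) (q₂ p.1 p.2) * f p.1 p.2 +
        G.Hs (q₁ p.1 p.2) (q₂ p.1 p.2) * g p.1 p.2) := by
  have hcomp : IsCompact (Icc t₀ t₁ ×ˢ K) := isCompact_Icc.prod hK
  have hq : ContinuousOn (fun p : ℝ × Space N => (q₁ p.1 p.2, q₂ p.1 p.2))
      (Icc t₀ t₁ ×ˢ closure Ω) := h₁.continuous_closure.prodMk h₂.continuous_closure
  have cr : ContinuousOn (fun p : ℝ × Space N => G.Hr (q₁ p.1 p.2) (q₂ p.1 p.2))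
      (Icc t₀ t₁ ×ˢ closure Ω) := G.continuous_Hr.comp_continuousOn hq
  have cs : ContinuousOn (fun p : ℝ × Space N => G.Hs (q₁ p.1 p.2) (q₂ p.1 p.2))
      (Icc t₀ t₁ ×ˢ closure Ω) := G.continuous_Hs.comp_continuousOn hq
  have cH : ContinuousOn (fun p : ℝ × Space N => G.H (q₁ p.1 p.2) (q₂ p.1 p.2))
      (Icc t₀ t₁ ×ˢ closure Ω) := G.continuous_H.comp_continuousOn hq
  set D : ℝ → Space N → ℝ := fun t x => G.Hr (q₁ t x) (q₂ t x) * deriv (fun s => q₁ s x) t +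
    G.Hs (q₁ t x) (q₂ t x) * deriv (fun s => q₂ s x) t with hD
  set S : ℝ → Space N → ℝ := fun t x => G.Hr (q₁ t x) (q₂ t x) * f t x +
    G.Hs (q₁ t x) (q₂ t x) * g t x with hS
  have hsub : Icc t₀ t₁ ×ˢ Ω ⊆ Icc t₀ t₁ ×ˢ closure Ω := prod_mono_right subset_closure
  have cD : ContinuousOn (fun p : ℝ × Space N => D p.1 p.2) (Icc t₀ t₁ ×ˢ Ω) :=
    ((cr.mono hsub).mul h₁.continuous_deriv_time).add
      ((cs.mono hsub).mul h₂.continuous_deriv_time)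
  have cS : ContinuousOn (fun p : ℝ × Space N => S p.1 p.2) (Icc t₀ t₁ ×ˢ closure Ω) :=
    (cr.mul h₁.continuous_source).add (cs.mul h₂.continuous_source)
  have hD0 : ∀ t ∈ Icc t₀ t₁, ∀ x ∈ Ω \ K, D t x = 0 := fun t ht x hx => by
    simp [hD, hr t ht x hx, hs t ht x hx]
  have iD : IntegrableOn (fun p : ℝ × Space N => D p.1 p.2) (Ioc t₀ t₁ ×ˢ Ω) := by
    refine IntegrableOn.mono_set (t := Icc t₀ t₁ ×ˢ Ω) ?_ (prod_mono_left Ioc_subset_Icc_self)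
    refine integrableOn_of_eq_zero_off_compact hcomp (prod_mono_right hKΩ)
      (measurableSet_Icc.prod hΩ.measurableSet) (cD.mono (prod_mono_right hKΩ)) ?_
    rintro ⟨t, x⟩ ⟨⟨ht, hx⟩, hn⟩
    exact hD0 t ht x ⟨hx, fun h => hn ⟨ht, h⟩⟩
  have iS := integrableOn_prod_of_continuousOn_closure hb cS
  have hftc : ∀ x ∈ Ω, G.H (q₁ t₁ x) (q₂ t₁ x) - G.H (q₁ t₀ x) (q₂ t₀ x) =
      ∫ t in Ioc t₀ t₁, D t x := by
    intro x hx
    rw [← intervalIntegral.integral_of_le h01]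
    symm
    refine intervalIntegral.integral_eq_sub_of_hasDerivAt
      (f := fun t => G.H (q₁ t x) (q₂ t x)) (fun t ht => ?_) ?_
    · rw [uIcc_of_le h01] at ht
      exact G.partials _ _ _ _ t (h₁.differentiable_time t ht x hx).hasDerivAt
        (h₂.differentiable_time t ht x hx).hasDerivAt
    · refine ContinuousOn.intervalIntegrable ?_
      rw [uIcc_of_le h01]
      exact continuousOn_time_slice cD hx
  have hslice : ∀ t ∈ Icc t₀ t₁, IntegrableOn (fun x => G.H (q₁ t x) (q₂ t x)) Ω := fun t ht =>
    integrableOn_of_continuousOn_closure hb (continuousOn_slice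
      (f := fun t x => G.H (q₁ t x) (q₂ t x)) cH ht)
  rw [← integral_sub (hslice t₁ ⟨h01, le_rfl⟩) (hslice t₀ ⟨le_rfl, h01⟩),
    setIntegral_congr_fun hΩ.measurableSet hftc]
  have hswap : ∫ x in Ω, ∫ t in Ioc t₀ t₁, D t x = ∫ t in Ioc t₀ t₁, ∫ x in Ω, D t x := by
    refine (integral_integral_swap ?_).symm
    rw [IntegrableOn, Measure.volume_eq_prod, ← Measure.prod_restrict] at iD
    exact iD
  rw [hswap, setIntegral_prod_Ioc (f := S) iS]
  have iD' : IntegrableOn (fun t => ∫ x in Ω, D t x) (Ioc t₀ t₁) := by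
    rw [IntegrableOn, Measure.volume_eq_prod, ← Measure.prod_restrict] at iD
    exact iD.integral_prod_left
  have iS' : IntegrableOn (fun t => ∫ x in Ω, S t x) (Ioc t₀ t₁) := by
    rw [IntegrableOn, Measure.volume_eq_prod, ← Measure.prod_restrict] at iS
    exact iS.integral_prod_left
  refine setIntegral_mono_on iD' iS' measurableSet_Ioc fun t ht => ?_
  have ht' := Ioc_subset_Icc_self ht
  have hd := integral_diffusion_nonpos hΩ hK hKΩ (h₁.contDiff_space t ht')
    (h₂.contDiff_space t ht') (hr t ht') (hs t ht') (hG t ht')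
  have iDt : IntegrableOn (D t) Ω := integrableOn_of_eq_zero_off_compact hK hKΩ hΩ.measurableSet
    ((continuousOn_slice cD ht').mono hKΩ) (hD0 t ht')
  have iSt : IntegrableOn (S t) Ω :=
    integrableOn_of_continuousOn_closure hb (continuousOn_slice cS ht')
  have hqt : ContinuousOn (fun x => (q₁ t x, q₂ t x)) Ω :=
    (h₁.contDiff_space t ht').continuousOn.prodMk (h₂.contDiff_space t ht').continuousOn
  have iL : IntegrableOn (fun x => G.Hr (q₁ t x) (q₂ t x) * (a * Laplacian.laplacian (q₁ t) x) +
      G.Hs (q₁ t x) (q₂ t x) * (b * Laplacian.laplacian (q₂ t) x)) Ω := by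
    refine integrableOn_of_eq_zero_off_compact hK hKΩ hΩ.measurableSet
      (ContinuousOn.mono ?_ hKΩ) fun x hx => by simp [hr t ht' x hx, hs t ht' x hx]
    exact ((G.continuous_Hr.comp_continuousOn hqt).mul
      (continuousOn_const.mul (continuousOn_laplacian hΩ (h₁.contDiff_space t ht')))).add
      ((G.continuous_Hs.comp_continuousOn hqt).mul
      (continuousOn_const.mul (continuousOn_laplacian hΩ (h₂.contDiff_space t ht'))))
  calc ∫ x in Ω, D t x ≤ ∫ x in Ω, ((G.Hr (q₁ t x) (q₂ t x) * (a * Laplacian.laplacian (q₁ t) x) +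
      G.Hs (q₁ t x) (q₂ t x) * (b * Laplacian.laplacian (q₂ t) x)) + S t x) := by
        refine setIntegral_mono_on iDt (iL.add iSt) hΩ.measurableSet fun x hx => ?_
        -- Monotonicity of the density is what allows the differential inequalities, rather than
        -- equations, to be multiplied by its gradient.
        have e1 := mul_le_mul_of_nonneg_left (h₁.le t ht' x hx) (hG t ht' x hx).Hr_nonneg
        have e2 := mul_le_mul_of_nonneg_left (h₂.le t ht' x hx) (hG t ht' x hx).Hs_nonneg
        simp only [hD, hS]
        linarith
    _ = _ + ∫ x in Ω, S t x := integral_add iL iSt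
    _ ≤ ∫ x in Ω, S t x := by linarith
end


/-! ### Removing the truncation -/

section
variable {N : ℕ} {Ω : Set (Space N)}

lemma exists_bound_on_box {F : ℝ → ℝ → ℝ} (hF : Continuous fun p : ℝ × ℝ => F p.1 p.2) (R : ℝ) :
    ∃ C, 0 ≤ C ∧ ∀ r s, 0 ≤ r → r ≤ R → 0 ≤ s → s ≤ R → |F r s| ≤ C := by
  obtain ⟨C, hC⟩ := (isCompact_Icc (a := (0 : ℝ)) (b := R)).prod (isCompact_Icc (a := (0 : ℝ))
    (b := R)) |>.exists_bound_of_continuousOn hF.continuousOn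
  exact ⟨|C|, abs_nonneg _, fun r s h0 h1 h2 h3 =>
    (hC (r, s) ⟨⟨h0, h1⟩, ⟨h2, h3⟩⟩).trans (le_abs_self C)⟩

lemma exists_bound_of_continuousOn_closure (hb : Bornology.IsBounded Ω) {t₀ t₁ : ℝ}
    {q : ℝ → Space N → ℝ}
    (hq : ContinuousOn (fun p : ℝ × Space N => q p.1 p.2) (Icc t₀ t₁ ×ˢ closure Ω)) :
    ∃ C, 0 ≤ C ∧ ∀ t ∈ Icc t₀ t₁, ∀ x ∈ closure Ω, |q t x| ≤ C := by
  obtain ⟨C, hC⟩ := (isCompact_Icc.prod hb.isCompact_closure).exists_bound_of_continuousOn hq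
  exact ⟨|C|, abs_nonneg _, fun t ht x hx => (hC (t, x) ⟨ht, hx⟩).trans (le_abs_self C)⟩

lemma continuousOn_comp₂ {X : Type*} [TopologicalSpace X] {F : ℝ → ℝ → ℝ}
    (hF : Continuous fun p : ℝ × ℝ => F p.1 p.2) {S : Set X} {q₁ q₂ : X → ℝ}
    (h₁ : ContinuousOn q₁ S) (h₂ : ContinuousOn q₂ S) :
    ContinuousOn (fun x => F (q₁ x) (q₂ x)) S :=
  hF.comp_continuousOn (h₁.prodMk h₂)

/-- Dominated convergence with a constant majorant. Integrability of the limit is part of the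
conclusion because the limits met below contain indicators and need not be continuous. -/
lemma tendsto_setIntegral_of_bounded {X : Type*} [TopologicalSpace X]
    [SecondCountableTopology X] [MeasurableSpace X] [OpensMeasurableSpace X] {μ : Measure X}
    {S : Set X} (hS : MeasurableSet S)
    (hfin : μ S ≠ ∞) {F : ℕ → X → ℝ} {F₀ : X → ℝ} (hF : ∀ k, ContinuousOn (F k) S) {C : ℝ}
    (hC : ∀ k, ∀ x ∈ S, |F k x| ≤ C)
    (hlim : ∀ x ∈ S, Tendsto (fun k => F k x) atTop (𝓝 (F₀ x))) :
    Tendsto (fun k => ∫ x in S, F k x ∂μ) atTop (𝓝 (∫ x in S, F₀ x ∂μ)) ∧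
      IntegrableOn F₀ S μ := by
  have hmeas : ∀ k, AEStronglyMeasurable (F k) (μ.restrict S) := fun k =>
    (hF k).aestronglyMeasurable hS
  have hb : ∀ k, ∀ᵐ x ∂μ.restrict S, ‖F k x‖ ≤ C := fun k => by
    filter_upwards [ae_restrict_mem hS] with x hx
    exact hC k x hx
  have hl : ∀ᵐ x ∂μ.restrict S, Tendsto (fun k => F k x) atTop (𝓝 (F₀ x)) := by
    filter_upwards [ae_restrict_mem hS] with x hx
    exact hlim x hx
  refine ⟨tendsto_integral_of_dominated_convergence (fun _ => C) hmeas
    (integrableOn_const hfin) hb hl, ?_⟩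
  refine Integrable.mono' (g := fun _ => C) (integrableOn_const hfin)
    (aestronglyMeasurable_of_tendsto_ae _ hmeas hl) ?_
  filter_upwards [ae_restrict_mem hS] with x hx
  exact le_of_tendsto (hlim x hx).norm (Eventually.of_forall fun k => hC k x hx)

lemma abs_mul_mul_le {h θ f A B : ℝ} (hh : |h| ≤ A) (hθ0 : 0 ≤ θ) (hθ1 : θ ≤ 1) (hf : |f| ≤ B) : |h * θ * f| ≤ A * B := by
  rw [abs_mul, abs_mul, abs_of_nonneg hθ0]
  refine mul_le_mul ?_ hf (abs_nonneg _) ((abs_nonneg _).trans hh)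
  calc |h| * θ ≤ |h| * 1 := mul_le_mul_of_nonneg_left hθ1 (abs_nonneg _)
    _ ≤ A := by rwa [mul_one]

/-- The energy inequality for two subsolutions. -/
theorem energy_le (hΩ : IsOpen Ω) (hb : Bornology.IsBounded Ω) {t₀ t₁ : ℝ}
    (h01 : t₀ ≤ t₁) {a b : ℝ} (ha : 0 ≤ a) (hb' : 0 ≤ b) {q₁ q₂ f g ρ : ℝ → Space N → ℝ}
    (D : Density)
    (h₁ : IsSubsolution Ω (Icc t₀ t₁) a q₁ f) (h₂ : IsSubsolution Ω (Icc t₀ t₁) b q₂ g)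
    (hD : ∀ t ∈ Icc t₀ t₁, ∀ x ∈ Ω, ∀ r s, 0 ≤ r → r ≤ max (q₁ t x) 0 → 0 ≤ s →
      s ≤ max (q₂ t x) 0 → D.Dissipative a b r s)
    (hρc : ContinuousOn (fun p : ℝ × Space N => ρ p.1 p.2) (Icc t₀ t₁ ×ˢ closure Ω))
    (hρ : ∀ t ∈ Icc t₀ t₁, ∀ x ∈ Ω,
      D.Hr (max (q₁ t x) 0) (max (q₂ t x) 0) * (if 0 < q₁ t x then 1 else 0) * f t x +
      D.Hs (max (q₁ t x) 0) (max (q₂ t x) 0) * (if 0 < q₂ t x then 1 else 0) * g t x ≤ ρ t x) :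
    (∫ x in Ω, D.H (max (q₁ t₁ x) 0) (max (q₂ t₁ x) 0)) -
      ∫ x in Ω, D.H (max (q₁ t₀ x) 0) (max (q₂ t₀ x) 0) ≤
      ∫ s in Ioc t₀ t₁, ∫ x in Ω, ρ s x := by
  obtain ⟨R₁, hR₁0, hR₁⟩ := exists_bound_of_continuousOn_closure hb h₁.continuous_closure
  obtain ⟨R₂, hR₂0, hR₂⟩ := exists_bound_of_continuousOn_closure hb h₂.continuous_closure
  obtain ⟨Cf, hCf0, hCf⟩ := exists_bound_of_continuousOn_closure hb h₁.continuous_source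
  obtain ⟨Cg, hCg0, hCg⟩ := exists_bound_of_continuousOn_closure hb h₂.continuous_source
  set R := max R₁ R₂
  have hR0 : 0 ≤ R := hR₁0.trans (le_max_left _ _)
  have htr₁ : ∀ k, ∀ t ∈ Icc t₀ t₁, ∀ x ∈ closure Ω, trunc k (q₁ t x) ≤ R := fun k t ht x hx =>
    (trunc_le _ _).trans (max_le (((le_abs_self _).trans (hR₁ t ht x hx)).trans
      (le_max_left _ _)) hR0)
  have htr₂ : ∀ k, ∀ t ∈ Icc t₀ t₁, ∀ x ∈ closure Ω, trunc k (q₂ t x) ≤ R := fun k t ht x hx =>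
    (trunc_le _ _).trans (max_le (((le_abs_self _).trans (hR₂ t ht x hx)).trans
      (le_max_right _ _)) hR0)
  obtain ⟨CH, hCH0, hCH⟩ := exists_bound_on_box D.continuous_H R
  obtain ⟨Cr, hCr0, hCr⟩ := exists_bound_on_box D.continuous_Hr R
  obtain ⟨Cs, hCs0, hCs⟩ := exists_bound_on_box D.continuous_Hs R
  have hfin : volume Ω ≠ ∞ := hb.measure_lt_top.ne
  have hfin' : volume (Ioc t₀ t₁ ×ˢ Ω) ≠ ∞ := by
    rw [Measure.volume_eq_prod, Measure.prod_prod]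
    exact ENNReal.mul_ne_top (by simp) hfin
  have hk : ∀ k : ℕ, (∫ x in Ω, (D.truncate k).H (q₁ t₁ x) (q₂ t₁ x)) -
      ∫ x in Ω, (D.truncate k).H (q₁ t₀ x) (q₂ t₀ x) ≤
      ∫ p in Ioc t₀ t₁ ×ˢ Ω, ((D.truncate k).Hr (q₁ p.1 p.2) (q₂ p.1 p.2) * f p.1 p.2 +
        (D.truncate k).Hs (q₁ p.1 p.2) (q₂ p.1 p.2) * g p.1 p.2) := by
    intro k
    -- The level is exactly the threshold below which `truncDeriv k` vanishes.
    obtain ⟨K, hK, hKΩ, hKδ⟩ := exists_compact_superlevel hΩ hb (δ := 1 / ((k : ℝ) + 1))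
      (by positivity) h₁.continuous_closure h₂.continuous_closure h₁.boundary h₂.boundary
    refine energy_le_of_eq_zero_off_compact hΩ hb h01 h₁ h₂ hK hKΩ (fun t ht x hx => ?_)
      (fun t ht x hx => ?_) fun t ht x hx => ?_
    · simp [Density.truncate, truncDeriv_of_le (hKδ t ht x hx).1]
    · simp [Density.truncate, truncDeriv_of_le (hKδ t ht x hx).2]
    · exact (hD t ht x hx _ _ (trunc_nonneg _ _) (trunc_le _ _) (trunc_nonneg _ _)
        (trunc_le _ _)).truncate ha hb'
  have hlim : ∀ t ∈ Icc t₀ t₁, Tendsto (fun k : ℕ => ∫ x in Ω, (D.truncate k).H (q₁ t x) (q₂ t x))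
      atTop (𝓝 (∫ x in Ω, D.H (max (q₁ t x) 0) (max (q₂ t x) 0))) := by
    intro t ht
    refine (tendsto_setIntegral_of_bounded hΩ.measurableSet hfin (fun k => ?_) (C := CH)
      (fun k x hx => ?_) fun x _ => ?_).1
    · exact continuousOn_comp₂ (D.truncate k).continuous_H
        (h₁.contDiff_space t ht).continuousOn (h₂.contDiff_space t ht).continuousOn
    · exact hCH _ _ (trunc_nonneg _ _) (htr₁ k t ht x (subset_closure hx)) (trunc_nonneg _ _)
        (htr₂ k t ht x (subset_closure hx))
    · exact (D.continuous_H.tendsto (max (q₁ t x) 0, max (q₂ t x) 0)).comp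
        ((tendsto_trunc _).prodMk_nhds (tendsto_trunc _))
  have hsub : Ioc t₀ t₁ ×ˢ Ω ⊆ Icc t₀ t₁ ×ˢ closure Ω :=
    prod_mono Ioc_subset_Icc_self subset_closure
  have hmS : MeasurableSet (Ioc t₀ t₁ ×ˢ Ω) := measurableSet_Ioc.prod hΩ.measurableSet
  have hcont : ∀ k : ℕ, ContinuousOn (fun p : ℝ × Space N =>
      (D.truncate k).Hr (q₁ p.1 p.2) (q₂ p.1 p.2) * f p.1 p.2 +
        (D.truncate k).Hs (q₁ p.1 p.2) (q₂ p.1 p.2) * g p.1 p.2) (Ioc t₀ t₁ ×ˢ Ω) := by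
    intro k
    have c1 := h₁.continuous_closure.mono hsub
    have c2 := h₂.continuous_closure.mono hsub
    exact ((continuousOn_comp₂ (D.truncate k).continuous_Hr c1 c2).mul
      (h₁.continuous_source.mono hsub)).add
      ((continuousOn_comp₂ (D.truncate k).continuous_Hs c1 c2).mul
      (h₂.continuous_source.mono hsub))
  have hbd : ∀ k : ℕ, ∀ p ∈ Ioc t₀ t₁ ×ˢ Ω,
      |(D.truncate k).Hr (q₁ p.1 p.2) (q₂ p.1 p.2) * f p.1 p.2 +
        (D.truncate k).Hs (q₁ p.1 p.2) (q₂ p.1 p.2) * g p.1 p.2| ≤ Cr * Cf + Cs * Cg := by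
    intro k p hp
    obtain ⟨ht, hx⟩ := hsub hp
    refine (abs_add_le _ _).trans (add_le_add ?_ ?_)
    · exact abs_mul_mul_le (hCr _ _ (trunc_nonneg _ _) (htr₁ k _ ht _ hx) (trunc_nonneg _ _)
        (htr₂ k _ ht _ hx)) (truncDeriv_nonneg _ _) (truncDeriv_le_one _ _) (hCf _ ht _ hx)
    · exact abs_mul_mul_le (hCs _ _ (trunc_nonneg _ _) (htr₁ k _ ht _ hx) (trunc_nonneg _ _)
        (htr₂ k _ ht _ hx)) (truncDeriv_nonneg _ _) (truncDeriv_le_one _ _) (hCg _ ht _ hx)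
  -- The derivatives of the truncations converge to the indicator of the open half-line, with value
  -- `0` at `0`; this produces the indicators in the hypothesis on `ρ`.
  have hpt : ∀ p ∈ Ioc t₀ t₁ ×ˢ Ω, Tendsto (fun k : ℕ =>
      (D.truncate k).Hr (q₁ p.1 p.2) (q₂ p.1 p.2) * f p.1 p.2 +
        (D.truncate k).Hs (q₁ p.1 p.2) (q₂ p.1 p.2) * g p.1 p.2) atTop
      (𝓝 (D.Hr (max (q₁ p.1 p.2) 0) (max (q₂ p.1 p.2) 0) *
        (if 0 < q₁ p.1 p.2 then 1 else 0) * f p.1 p.2 +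
        D.Hs (max (q₁ p.1 p.2) 0) (max (q₂ p.1 p.2) 0) *
        (if 0 < q₂ p.1 p.2 then 1 else 0) * g p.1 p.2)) := by
    intro p _
    have l1 := tendsto_trunc (q₁ p.1 p.2)
    have l2 := tendsto_trunc (q₂ p.1 p.2)
    have m1 := (D.continuous_Hr.tendsto (max (q₁ p.1 p.2) 0, max (q₂ p.1 p.2) 0)).comp
      (l1.prodMk_nhds l2)
    have m2 := (D.continuous_Hs.tendsto (max (q₁ p.1 p.2) 0, max (q₂ p.1 p.2) 0)).comp
      (l1.prodMk_nhds l2)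
    exact ((m1.mul (tendsto_truncDeriv _)).mul_const _).add
      ((m2.mul (tendsto_truncDeriv _)).mul_const _)
  obtain ⟨hlimR, hint⟩ := tendsto_setIntegral_of_bounded (μ := volume) hmS hfin' hcont hbd hpt
  have hρi := integrableOn_prod_of_continuousOn_closure hb hρc
  have hle := setIntegral_mono_on hint hρi hmS fun p hp =>
    hρ p.1 (Ioc_subset_Icc_self hp.1) p.2 hp.2
  rw [setIntegral_prod_Ioc hρi] at hle
  exact (le_of_tendsto_of_tendsto' ((hlim t₁ ⟨h01, le_rfl⟩).sub (hlim t₀ ⟨le_rfl, h01⟩)) hlimR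
    hk).trans hle
end


/-! ### Gronwall's lemma in integral form and a maximum principle -/

/-- The increment bound for all pairs `s ≤ t` controls the right difference quotients of `E` at `x`
by means of `r`, which tend to `r x`. Knowing it only from `t₀` would not suffice for negative `K`,
the case that gives bounds uniform in time. -/
lemma le_gronwallBound_of_sub_le_integral {E r : ℝ → ℝ} {t₀ t₁ K ε : ℝ}
    (hE : ContinuousOn E (Icc t₀ t₁)) (hr : ContinuousOn r (Icc t₀ t₁))
    (hEr : ∀ s ∈ Icc t₀ t₁, ∀ t ∈ Icc t₀ t₁, s ≤ t → E t - E s ≤ ∫ y in Ioc s t, r y)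
    (hle : ∀ t ∈ Icc t₀ t₁, r t ≤ K * E t + ε) {t : ℝ} (ht : t ∈ Icc t₀ t₁) :
    E t ≤ gronwallBound (E t₀) K ε (t - t₀) := by
  refine le_gronwallBound_of_liminf_deriv_right_le hE (f' := r) ?_ le_rfl
    (fun x hx => hle x (Ico_subset_Icc_self hx)) t ht
  intro x hx c hc
  refine Eventually.frequently ?_
  -- The intermediate value `c'` leaves room for a strict inequality after averaging.
  obtain ⟨c', hc', hc'c⟩ := exists_between hc
  have hev : ∀ᶠ y in 𝓝[Icc t₀ t₁] x, r y < c' :=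
    (hr x (Ico_subset_Icc_self hx)).eventually (gt_mem_nhds hc')
  obtain ⟨δ, hδ, hball⟩ := Metric.mem_nhdsWithin_iff.1 hev
  have hz : Ioo x (min t₁ (x + δ)) ∈ 𝓝[>] x :=
    Ioo_mem_nhdsGT (lt_min hx.2 (by linarith))
  filter_upwards [hz] with z hz
  have hzt : z < t₁ := hz.2.trans_le (min_le_left _ _)
  have hzδ : z < x + δ := hz.2.trans_le (min_le_right _ _)
  have hzmem : z ∈ Icc t₀ t₁ := ⟨hx.1.trans hz.1.le, hzt.le⟩
  have hsub : Icc x z ⊆ Icc t₀ t₁ := Icc_subset_Icc hx.1 hzt.le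
  have hint : ∫ y in Ioc x z, r y ≤ ∫ _ in Ioc x z, c' := by
    refine setIntegral_mono_on (((hr.mono hsub).integrableOn_Icc).mono_set Ioc_subset_Icc_self)
      (by simp) measurableSet_Ioc fun y hy => ?_
    have : y ∈ {y | r y < c'} := hball ⟨by
      rw [Metric.mem_ball, Real.dist_eq, abs_lt]
      constructor <;> linarith [hy.1, hy.2], hsub (Ioc_subset_Icc_self hy)⟩
    exact le_of_lt this
  have h1 := (hEr x (Ico_subset_Icc_self hx) z hzmem hz.1.le).trans hint
  rw [setIntegral_const, smul_eq_mul, measureReal_def, Real.volume_Ioc,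
    ENNReal.toReal_ofReal (by linarith [hz.1])] at h1
  have hpos : 0 < z - x := by linarith [hz.1]
  rw [inv_mul_lt_iff₀ hpos]
  nlinarith

section
variable {N : ℕ} {Ω : Set (Space N)}

lemma continuousOn_setIntegral_slice (hb : Bornology.IsBounded Ω) {t₀ t₁ : ℝ}
    {F : ℝ → Space N → ℝ}
    (hF : ContinuousOn (fun p : ℝ × Space N => F p.1 p.2) (Icc t₀ t₁ ×ˢ closure Ω)) :
    ContinuousOn (fun t => ∫ x in Ω, F t x) (Icc t₀ t₁) := by
  obtain ⟨C, hC0, hC⟩ := exists_bound_of_continuousOn_closure hb hF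
  have hrestr : ∀ᵐ x ∂(volume.restrict Ω), x ∈ closure Ω :=
    ae_restrict_of_ae_restrict_of_subset subset_closure
      (ae_restrict_mem isClosed_closure.measurableSet)
  refine continuousOn_of_dominated (bound := fun _ => C)
    (fun t ht => (integrableOn_of_continuousOn_closure hb (continuousOn_slice hF ht)).1)
    (fun t ht => ?_) (integrableOn_const hb.measure_lt_top.ne) ?_
  · filter_upwards [hrestr] with x hx
    exact hC t ht x hx
  · filter_upwards [hrestr] with x hx
    exact continuousOn_time_slice hF hx

lemma Density.dissipative_fst (a b r s : ℝ) : Density.fst.Dissipative a b r s where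
  Hr_nonneg := zero_le_one
  Hs_nonneg := le_rfl
  form_nonneg ξ ζ := by simp [Density.fst]

/-- A Kato-type inequality: the energy estimate with density `H(r, s) = r`, taking `q` for both
functions. Only the source on `{q > 0}` contributes. -/
lemma integral_posPart_le (hΩ : IsOpen Ω) (hb : Bornology.IsBounded Ω) {t₀ t₁ : ℝ}
    (h01 : t₀ ≤ t₁) {κ : ℝ} (hκ : 0 ≤ κ) {q f ρ : ℝ → Space N → ℝ}
    (h : IsSubsolution Ω (Icc t₀ t₁) κ q f)
    (hρc : ContinuousOn (fun p : ℝ × Space N => ρ p.1 p.2) (Icc t₀ t₁ ×ˢ closure Ω))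
    (hρ0 : ∀ t ∈ Icc t₀ t₁, ∀ x ∈ Ω, 0 ≤ ρ t x)
    (hρ : ∀ t ∈ Icc t₀ t₁, ∀ x ∈ Ω, 0 < q t x → f t x ≤ ρ t x) :
    (∫ x in Ω, max (q t₁ x) 0) - ∫ x in Ω, max (q t₀ x) 0 ≤ ∫ s in Ioc t₀ t₁, ∫ x in Ω, ρ s x := by
  refine energy_le hΩ hb h01 hκ hκ Density.fst h h
    (fun _ _ _ _ _ _ _ _ _ _ => Density.dissipative_fst _ _ _ _) hρc fun t ht x hx => ?_
  by_cases hq : 0 < q t x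
  · simpa [Density.fst, hq] using hρ t ht x hx hq
  · simpa [Density.fst, hq] using hρ0 t ht x hx

lemma Icc_subset_timeInterval {T : EReal} {t₀ t₁ : ℝ} (h₀ : 0 < t₀) (h₁ : t₁ ∈ timeInterval T) :
    Icc t₀ t₁ ⊆ timeInterval T := fun _ ht =>
  ⟨h₀.trans_le ht.1, (EReal.coe_le_coe_iff.2 ht.2).trans_lt h₁.2⟩

lemma continuousOn_posPart {S : Set (ℝ × Space N)} {q : ℝ → Space N → ℝ}
    (hq : ContinuousOn (fun p : ℝ × Space N => q p.1 p.2) S) :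
    ContinuousOn (fun p : ℝ × Space N => max (q p.1 p.2) 0) S :=
  (continuous_id.max continuous_const).comp_continuousOn hq

lemma nonpos_of_integral_posPart_eq_zero (hΩ : IsOpen Ω) (hb : Bornology.IsBounded Ω)
    {q : Space N → ℝ} (hq : ContinuousOn q (closure Ω)) (h : ∫ x in Ω, max (q x) 0 ≤ 0) :
    ∀ x ∈ Ω, q x ≤ 0 := by
  have hc : ContinuousOn (fun x => max (q x) 0) (closure Ω) :=
    (continuous_id.max continuous_const).comp_continuousOn hq
  have h0 : ∫ x in Ω, max (q x) 0 = 0 :=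
    le_antisymm h (integral_nonneg fun x => le_max_right _ _)
  have hnn : 0 ≤ᵐ[volume.restrict Ω] fun x => max (q x) 0 :=
    Eventually.of_forall fun x => le_max_right _ _
  rw [setIntegral_eq_zero_iff_of_nonneg_ae hnn
    (integrableOn_of_continuousOn_closure hb hc)] at h0
  have := Measure.eqOn_open_of_ae_eq h0 hΩ (hc.mono subset_closure) continuousOn_const
  intro x hx
  have hx0 : max (q x) 0 = 0 := this hx
  exact max_eq_right_iff.1 hx0

/-- Maximum principle for quasi-monotone systems of subsolutions whose positive parts vanish
initially in the mean. -/
theorem nonpos_of_isSubsolution {ι : Type*} [Fintype ι] (hΩ : IsOpen Ω)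
    (hb : Bornology.IsBounded Ω) {T : EReal} {κ : ι → ℝ} (hκ : ∀ i, 0 ≤ κ i)
    {q f : ι → ℝ → Space N → ℝ} (h : ∀ i, IsSubsolution Ω (timeInterval T) (κ i) (q i) (f i))
    {C : ℝ} (hC : 0 ≤ C) {s : ℝ} (hs : s ∈ timeInterval T)
    (hf : ∀ i, ∀ t ∈ Ioc 0 s, ∀ x ∈ Ω, 0 < q i t x → f i t x ≤ C * ∑ j, max (q j t x) 0)
    (h0 : ∀ i, Tendsto (fun t => ∫ x in Ω, max (q i t x) 0) (𝓝[>] 0) (𝓝 0)) (i : ι) :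
    ∀ x ∈ Ω, q i s x ≤ 0 := by
  set E : ℝ → ℝ := fun t => ∑ j, ∫ x in Ω, max (q j t x) 0 with hE
  -- Each component grows at rate at most `C * E`; summing over the components gives the factor
  -- `card ι`.
  set K : ℝ := Fintype.card ι * C with hK
  -- Continuity at time `0` is not available, so Gronwall starts at `t₀ > 0` and `t₀ → 0` is taken
  -- afterwards.
  have hbound : ∀ t₀ ∈ Ioo 0 s, E s ≤ E t₀ * Real.exp (K * (s - t₀)) := by
    intro t₀ ht₀
    have hJ : Icc t₀ s ⊆ timeInterval T := Icc_subset_timeInterval ht₀.1 hs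
    have hcq : ∀ j, ContinuousOn (fun p : ℝ × Space N => max (q j p.1 p.2) 0)
        (Icc t₀ s ×ˢ closure Ω) := fun j =>
      continuousOn_posPart ((h j).mono hJ).continuous_closure
    have hcE : ContinuousOn E (Icc t₀ s) :=
      continuousOn_finsetSum _ fun j _ => continuousOn_setIntegral_slice hb (hcq j)
    have hcρ : ContinuousOn (fun p : ℝ × Space N => C * ∑ j, max (q j p.1 p.2) 0)
        (Icc t₀ s ×ˢ closure Ω) :=
      continuousOn_const.mul (continuousOn_finsetSum _ fun j _ => hcq j)
    have hρE : ∀ t ∈ Icc t₀ s, ∫ x in Ω, C * ∑ j, max (q j t x) 0 = C * E t := by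
      intro t ht
      rw [integral_const_mul, integral_finsetSum]
      exact fun j _ => integrableOn_of_continuousOn_closure hb
        (continuousOn_slice (f := fun t x => max (q j t x) 0) (hcq j) ht)
    have := le_gronwallBound_of_sub_le_integral (r := fun t => K * E t) (K := K) (ε := 0) hcE
      (continuousOn_const.mul hcE) (fun a ha b hb' hab => ?_) (fun t _ => by simp)
      (right_mem_Icc.2 ht₀.2.le)
    · rwa [gronwallBound_ε0] at this
    · have hab' : Icc a b ⊆ Icc t₀ s := Icc_subset_Icc ha.1 hb'.2
      have hj : ∀ j, (∫ x in Ω, max (q j b x) 0) - ∫ x in Ω, max (q j a x) 0 ≤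
          ∫ t in Ioc a b, C * E t := by
        intro j
        refine (integral_posPart_le hΩ hb hab (hκ j) ((h j).mono (hab'.trans hJ))
          (ρ := fun t x => C * ∑ j, max (q j t x) 0) (hcρ.mono (prod_mono_left hab'))
          (fun t _ x _ => mul_nonneg hC (Finset.sum_nonneg fun _ _ => le_max_right _ _))
          fun t ht x hx hq => hf j t ⟨ht₀.1.trans_le (hab' ht).1, (hab' ht).2⟩ x hx hq).trans_eq ?_
        exact setIntegral_congr_fun measurableSet_Ioc fun t ht =>
          hρE t (hab' (Ioc_subset_Icc_self ht))
      calc E b - E a = ∑ j, ((∫ x in Ω, max (q j b x) 0) - ∫ x in Ω, max (q j a x) 0) := by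
            simp [hE]
        _ ≤ ∑ j : ι, ∫ t in Ioc a b, C * E t := Finset.sum_le_sum fun j _ => hj j
        _ = ∫ t in Ioc a b, K * E t := by
            simp only [integral_const_mul, Finset.sum_const, Finset.card_univ, nsmul_eq_mul, hK]
            ring
  have hlim : Tendsto (fun t₀ => E t₀ * Real.exp (K * (s - t₀))) (𝓝[>] 0)
      (𝓝 (0 * Real.exp (K * (s - 0)))) := by
    refine Tendsto.mul ?_ ?_
    · simpa using tendsto_finsetSum _ fun j (_ : j ∈ Finset.univ) => h0 j
    · exact (Continuous.tendsto (by fun_prop) 0).mono_left nhdsWithin_le_nhds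
  rw [zero_mul] at hlim
  have hEs : E s ≤ 0 := ge_of_tendsto hlim (by
    filter_upwards [Ioo_mem_nhdsGT hs.1] with t₀ ht₀ using hbound t₀ ht₀)
  refine nonpos_of_integral_posPart_eq_zero hΩ hb
    (continuousOn_slice (h i).continuous_closure hs) (le_trans ?_ hEs)
  exact Finset.single_le_sum (f := fun j => ∫ x in Ω, max (q j s x) 0)
    (fun j _ => integral_nonneg fun x => le_max_right _ _) (Finset.mem_univ i)

/-! ### Classical components as subsolutions -/

lemma hasFDerivAt_norm_sq' (x : Space N) :
    HasFDerivAt (fun y : Space N => ‖y‖ ^ 2) ((2 : ℝ) • innerSL ℝ x) x := by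
  refine (hasStrictFDerivAt_norm_sq x).hasFDerivAt.congr_fderiv ?_
  ext y
  simp

lemma laplacian_norm_sq (x : Space N) :
    Laplacian.laplacian (fun y : Space N => ‖y‖ ^ 2) x = 2 * N := by
  have h1 : fderiv ℝ (fun y : Space N => ‖y‖ ^ 2) = fun y => (2 : ℝ) • innerSL ℝ y :=
    funext fun y => (hasFDerivAt_norm_sq' y).fderiv
  have h2 : fderiv ℝ (fun y : Space N => (2 : ℝ) • innerSL ℝ y) x = (2 : ℝ) • innerSL ℝ :=
    (((innerSL ℝ : Space N →L[ℝ] Space N →L[ℝ] ℝ)).hasFDerivAt.const_smul (2 : ℝ)).fderiv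
  have h3 : ∀ e : Space N, ((2 : ℝ) • (innerSL ℝ : Space N →L[ℝ] Space N →L[ℝ] ℝ)) e e =
      2 * inner ℝ e e := fun e => rfl
  rw [laplacian_eq_sum, h1, h2]
  simp only [h3]
  simp [mul_comm]

/-- One affine family covers every use: `σ = -1` without correction for nonnegativity, `σ = 1` with
a paraboloid for the bound on the inhibitors, and `σ = 1` without correction for the energy. The
shift in the source comes from `Δ |x|² = 2N`. -/
lemma IsClassicalComponent.isSubsolution {T : EReal} {u₀ : Space N → ℝ}
    {u f : ℝ → Space N → ℝ} {κ : ℝ} (hΩ : IsOpen Ω) (h : IsClassicalComponent Ω T u₀ u)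
    (hf : ContinuousOn (fun p : ℝ × Space N => f p.1 p.2) (timeInterval T ×ˢ closure Ω))
    (heq : ∀ t ∈ timeInterval T, ∀ x ∈ Ω,
      deriv (fun s => u s x) t - κ * Laplacian.laplacian (u t) x = f t x) (σ c₀ c₁ : ℝ)
    (hbd : ∀ x ∈ frontier Ω, c₀ + c₁ * ‖x‖ ^ 2 ≤ 0) :
    IsSubsolution Ω (timeInterval T) κ (fun t x => σ * u t x + (c₀ + c₁ * ‖x‖ ^ 2))
      (fun t x => σ * f t x - κ * (c₁ * (2 * N))) := by
  have hd : ∀ t ∈ timeInterval T, ∀ x ∈ Ω,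
      HasDerivAt (fun s => σ * u s x + (c₀ + c₁ * ‖x‖ ^ 2)) (σ * deriv (fun s => u s x) t) t :=
    fun t ht x hx => ((h.regular.differentiable_time t ht x hx).hasDerivAt.const_mul σ).add_const _
  have hsm : ContDiff ℝ 2 fun x : Space N => c₁ * ‖x‖ ^ 2 := contDiff_const.mul (contDiff_norm_sq ℝ)
  have hψ : ContDiff ℝ 2 fun x : Space N => c₀ + c₁ * ‖x‖ ^ 2 := contDiff_const.add hsm
  refine ⟨fun t ht x hx => (hd t ht x hx).differentiableAt, ?_, fun t ht => ?_, ?_,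
    fun t ht x hx => ?_, ?_, fun t ht x hx => ?_⟩
  · exact (continuousOn_const.mul h.regular.continuous_deriv_time).congr
      fun p hp => (hd p.1 hp.1 p.2 hp.2).deriv
  · exact (contDiffOn_const.mul (h.regular.contDiff_space t ht)).add hψ.contDiffOn
  · exact (continuousOn_const.mul h.continuous_closure).add
      (hψ.continuous.comp continuous_snd).continuousOn
  · simpa [h.dirichlet t ht x hx] using hbd x hx
  · exact (continuousOn_const.mul hf).sub continuousOn_const
  · have hu : ContDiffAt ℝ 2 (u t) x := (h.regular.contDiff_space t ht).contDiffAt (hΩ.mem_nhds hx)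
    have hL : Laplacian.laplacian (fun y => σ * u t y + (c₀ + c₁ * ‖y‖ ^ 2)) x =
        σ * Laplacian.laplacian (u t) x + c₁ * (2 * N) := by
      have e1 : (fun y => σ * u t y + (c₀ + c₁ * ‖y‖ ^ 2)) =
          (σ • u t) + ((fun _ => c₀) + c₁ • fun y : Space N => ‖y‖ ^ 2) := by
        ext y; simp
      have hn : ContDiffAt ℝ 2 (fun y : Space N => ‖y‖ ^ 2) x := (contDiff_norm_sq ℝ).contDiffAt
      have hσ : ContDiffAt ℝ 2 (σ • u t) x := hu.const_smul σ
      have hc₁ : ContDiffAt ℝ 2 (c₁ • fun y : Space N => ‖y‖ ^ 2) x := hn.const_smul c₁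
      have hc₀ : ContDiffAt ℝ 2 (fun _ : Space N => c₀) x := contDiffAt_const
      have hc₀₁ : ContDiffAt ℝ 2 ((fun _ => c₀) + c₁ • fun y : Space N => ‖y‖ ^ 2) x := hc₀.add hc₁
      rw [e1, hσ.laplacian_add hc₀₁, hc₀.laplacian_add hc₁, InnerProductSpace.laplacian_smul σ hu,
        InnerProductSpace.laplacian_smul c₁ hn, laplacian_norm_sq]
      simp
    rw [(hd t ht x hx).deriv, hL, ← heq t ht x hx]
    apply le_of_eq
    ring

/-- If the datum lies on the admissible side of the barrier, the excess at time `t` is at most the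
deviation from the datum, which tends to zero in `L¹`. -/
lemma IsClassicalComponent.tendsto_integral_posPart {T : EReal} (hT : 0 < T) {u₀ : Space N → ℝ}
    {u q : ℝ → Space N → ℝ} (hb : Bornology.IsBounded Ω) (h : IsClassicalComponent Ω T u₀ u)
    (hq : ContinuousOn (fun p : ℝ × Space N => q p.1 p.2) (timeInterval T ×ˢ closure Ω))
    (hle : ∀ᵐ x ∂(volume.restrict Ω), ∀ t, max (q t x) 0 ≤ |u t x - u₀ x|) :
    Tendsto (fun t => ∫ x in Ω, max (q t x) 0) (𝓝[>] 0) (𝓝 0) := by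
  have hmem : ∀ᶠ t in 𝓝[>] (0 : ℝ), t ∈ timeInterval T := by
    obtain ⟨s, hs0, hsT⟩ := EReal.lt_iff_exists_real_btwn.1 hT
    have hs0' : (0 : ℝ) < s := by exact_mod_cast hs0
    filter_upwards [Ioo_mem_nhdsGT hs0'] with t ht
    exact ⟨ht.1, (EReal.coe_lt_coe_iff.2 ht.2).trans hsT⟩
  have hlim : Tendsto (fun t => ∫⁻ x in Ω, ENNReal.ofReal (max (q t x) 0)) (𝓝[>] 0) (𝓝 0) := by
    refine tendsto_of_tendsto_of_tendsto_of_le_of_le tendsto_const_nhds h.initial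
      (fun t => zero_le) fun t => ?_
    show _ ≤ eLpNorm (fun x => u t x - u₀ x) 1 (volume.restrict Ω)
    rw [eLpNorm_one_eq_lintegral_enorm]
    refine lintegral_mono_ae ?_
    filter_upwards [hle] with x hx
    rw [Real.enorm_eq_ofReal_abs]
    exact ENNReal.ofReal_le_ofReal (hx t)
  have := (ENNReal.tendsto_toReal ENNReal.zero_ne_top).comp hlim
  rw [ENNReal.toReal_zero] at this
  refine this.congr' ?_
  filter_upwards [hmem] with t ht
  have hnn : 0 ≤ᵐ[volume.restrict Ω] fun x => max (q t x) 0 :=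
    Eventually.of_forall fun x => le_max_right _ _
  rw [Function.comp_apply, integral_eq_lintegral_of_nonneg_ae hnn]
  exact (integrableOn_of_continuousOn_closure hb (continuousOn_slice
    (f := fun t x => max (q t x) 0) (continuousOn_posPart hq) ht)).1
end


/-! ### Nonnegativity -/

/-- Quasi-positivity: where `u < 0`, the constant and linear terms push upwards. The cubic term has
no sign, as `v` may still be negative, but on bounded values it is Lipschitz-small: `-(u² v) ≤ M²
(-u)`. -/
lemma autocatalyst_source_neg_le {α β D M u v w : ℝ} (hα : 0 < α) (hβ : 0 < β) (hD : 0 < D)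
    (hu : |u| ≤ M) (hv : |v| ≤ M) (hneg : u < 0) :
    -(α - (β + 1) * u + u ^ 2 * v + D * (w - u)) ≤ M ^ 2 * max (-u) 0 + D * max (-w) 0 := by
  have hM : 0 ≤ M := (abs_nonneg _).trans hu
  have h1 : max (-u) 0 = -u := max_eq_left (by linarith)
  have h2 : D * (-w) ≤ D * max (-w) 0 := mul_le_mul_of_nonneg_left (le_max_left _ _) hD.le
  have h3 : -(u ^ 2 * v) ≤ M ^ 2 * -u := by
    have e1 : -v ≤ M := (neg_le_abs v).trans hv
    have e2 : -u ≤ M := (neg_le_abs u).trans hu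
    calc -(u ^ 2 * v) = u ^ 2 * -v := by ring
      _ ≤ u ^ 2 * M := mul_le_mul_of_nonneg_left e1 (sq_nonneg u)
      _ = (-u) * ((-u) * M) := by ring
      _ ≤ (-u) * (M * M) :=
        mul_le_mul_of_nonneg_left (mul_le_mul_of_nonneg_right e2 hM) (by linarith)
      _ = M ^ 2 * -u := by ring
  have h4 : (β + 1) * u ≤ 0 := mul_nonpos_of_nonneg_of_nonpos (by linarith) hneg.le
  have h5 : D * u ≤ 0 := mul_nonpos_of_nonneg_of_nonpos hD.le hneg.le
  rw [h1]
  linarith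

/-- Here the cubic term itself has the good sign where `v < 0`, so no bound on the values is needed.
-/
lemma inhibitor_source_neg_le {β D u v z : ℝ} (hβ : 0 < β) (hD : 0 < D) (hneg : v < 0) :
    -(β * u - u ^ 2 * v + D * (z - v)) ≤ β * max (-u) 0 + D * max (-z) 0 := by
  have h1 : β * (-u) ≤ β * max (-u) 0 := mul_le_mul_of_nonneg_left (le_max_left _ _) hβ.le
  have h2 : D * (-z) ≤ D * max (-z) 0 := mul_le_mul_of_nonneg_left (le_max_left _ _) hD.le
  have h3 : u ^ 2 * v ≤ 0 := mul_nonpos_of_nonneg_of_nonpos (sq_nonneg u) hneg.le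
  have h4 : D * v ≤ 0 := mul_nonpos_of_nonneg_of_nonpos hD.le hneg.le
  linarith

section
variable {N : ℕ} {Ω : Set (Space N)} {a b c d α β D₁ D₂ D₃ D₄ : ℝ} {u₀ v₀ w₀ z₀ : Space N → ℝ}
  {T : EReal} {u v w z : ℝ → Space N → ℝ}

lemma continuousOn_autocatalyst_source {S : Set (ℝ × Space N)}
    (hu : ContinuousOn (fun p : ℝ × Space N => u p.1 p.2) S)
    (hv : ContinuousOn (fun p : ℝ × Space N => v p.1 p.2) S)
    (hw : ContinuousOn (fun p : ℝ × Space N => w p.1 p.2) S) (α β D : ℝ) :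
    ContinuousOn (fun p : ℝ × Space N => α - (β + 1) * u p.1 p.2 + u p.1 p.2 ^ 2 * v p.1 p.2 +
      D * (w p.1 p.2 - u p.1 p.2)) S := by
  fun_prop

lemma continuousOn_inhibitor_source {S : Set (ℝ × Space N)}
    (hu : ContinuousOn (fun p : ℝ × Space N => u p.1 p.2) S)
    (hv : ContinuousOn (fun p : ℝ × Space N => v p.1 p.2) S)
    (hz : ContinuousOn (fun p : ℝ × Space N => z p.1 p.2) S) (β D : ℝ) :
    ContinuousOn (fun p : ℝ × Space N => β * u p.1 p.2 - u p.1 p.2 ^ 2 * v p.1 p.2 +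
      D * (z p.1 p.2 - v p.1 p.2)) S := by
  fun_prop

/-- Every component of a solution, transformed affinely, is a subsolution if the transformed
function is nonpositive on the boundary. -/
lemma IsSolution.isSubsolution (hΩ : IsOpen Ω)
    (h : IsSolution Ω a b c d α β D₁ D₂ D₃ D₄ u₀ v₀ w₀ z₀ T u v w z) (σ c₀ c₁ : ℝ)
    (hbd : ∀ x ∈ frontier Ω, c₀ + c₁ * ‖x‖ ^ 2 ≤ 0) :
    IsSubsolution Ω (timeInterval T) a (fun t x => σ * u t x + (c₀ + c₁ * ‖x‖ ^ 2))
      (fun t x => σ * (α - (β + 1) * u t x + u t x ^ 2 * v t x + D₁ * (w t x - u t x)) -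
        a * (c₁ * (2 * N))) ∧
    IsSubsolution Ω (timeInterval T) b (fun t x => σ * v t x + (c₀ + c₁ * ‖x‖ ^ 2))
      (fun t x => σ * (β * u t x - u t x ^ 2 * v t x + D₂ * (z t x - v t x)) -
        b * (c₁ * (2 * N))) ∧
    IsSubsolution Ω (timeInterval T) c (fun t x => σ * w t x + (c₀ + c₁ * ‖x‖ ^ 2))
      (fun t x => σ * (α - (β + 1) * w t x + w t x ^ 2 * z t x + D₃ * (u t x - w t x)) -
        c * (c₁ * (2 * N))) ∧
    IsSubsolution Ω (timeInterval T) d (fun t x => σ * z t x + (c₀ + c₁ * ‖x‖ ^ 2))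
      (fun t x => σ * (β * w t x - w t x ^ 2 * z t x + D₄ * (v t x - z t x)) -
        d * (c₁ * (2 * N))) := by
  have cu := h.comp_u.continuous_closure
  have cv := h.comp_v.continuous_closure
  have cw := h.comp_w.continuous_closure
  have cz := h.comp_z.continuous_closure
  exact ⟨h.comp_u.isSubsolution hΩ (continuousOn_autocatalyst_source cu cv cw α β D₁) h.eq_u
      σ c₀ c₁ hbd,
    h.comp_v.isSubsolution hΩ (continuousOn_inhibitor_source cu cv cz β D₂) h.eq_v σ c₀ c₁ hbd,
    h.comp_w.isSubsolution hΩ (continuousOn_autocatalyst_source cw cz cu α β D₃) h.eq_w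
      σ c₀ c₁ hbd,
    h.comp_z.isSubsolution hΩ (continuousOn_inhibitor_source cw cz cv β D₄) h.eq_z σ c₀ c₁ hbd⟩

lemma ae_posPart_neg_le {y₀ : Space N → ℝ} (y : ℝ → Space N → ℝ)
    (hy₀ : ∀ᵐ x ∂(volume.restrict Ω), 0 ≤ y₀ x) :
    ∀ᵐ x ∂(volume.restrict Ω), ∀ t,
      max (-1 * y t x + (0 + 0 * ‖x‖ ^ 2)) 0 ≤ |y t x - y₀ x| := by
  filter_upwards [hy₀] with x hx t
  refine max_le ?_ (abs_nonneg _)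
  linarith [neg_le_abs (y t x - y₀ x)]

theorem IsSolution.nonneg (hΩ : IsOpen Ω) (hb : Bornology.IsBounded Ω)
    (ha : 0 < a) (hb' : 0 < b) (hc : 0 < c) (hd : 0 < d) (hα : 0 < α) (hβ : 0 < β)
    (hD₁ : 0 < D₁) (hD₂ : 0 < D₂) (hD₃ : 0 < D₃) (hD₄ : 0 < D₄)
    (hu₀ : ∀ᵐ x ∂(volume.restrict Ω), 0 ≤ u₀ x) (hv₀ : ∀ᵐ x ∂(volume.restrict Ω), 0 ≤ v₀ x)
    (hw₀ : ∀ᵐ x ∂(volume.restrict Ω), 0 ≤ w₀ x) (hz₀ : ∀ᵐ x ∂(volume.restrict Ω), 0 ≤ z₀ x)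
    (hT : 0 < T) (h : IsSolution Ω a b c d α β D₁ D₂ D₃ D₄ u₀ v₀ w₀ z₀ T u v w z)
    {s : ℝ} (hs : s ∈ timeInterval T) :
    ∀ x ∈ Ω, 0 ≤ u s x ∧ 0 ≤ v s x ∧ 0 ≤ w s x ∧ 0 ≤ z s x := by
  obtain ⟨Mu, hMu⟩ := h.comp_u.locally_bounded s hs
  obtain ⟨Mv, hMv⟩ := h.comp_v.locally_bounded s hs
  obtain ⟨Mw, hMw⟩ := h.comp_w.locally_bounded s hs
  obtain ⟨Mz, hMz⟩ := h.comp_z.locally_bounded s hs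
  obtain ⟨su, sv, sw, sz⟩ := h.isSubsolution hΩ (-1) 0 0 (by simp)
  set M := max (max Mu Mv) (max Mw Mz) with hM
  -- A single constant dominating every coefficient in the four quasi-positivity estimates. It
  -- depends on the time `s` through `M`, which is harmless since the conclusion is a sign.
  set C := M ^ 2 + β + D₁ + D₂ + D₃ + D₄ with hC
  have hM2 : 0 ≤ M ^ 2 := sq_nonneg M
  have hC0 : 0 ≤ C := by positivity
  have key := nonpos_of_isSubsolution (ι := Fin 4) (κ := ![a, b, c, d])
    (q := ![fun t x => -1 * u t x + (0 + 0 * ‖x‖ ^ 2), fun t x => -1 * v t x + (0 + 0 * ‖x‖ ^ 2),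
      fun t x => -1 * w t x + (0 + 0 * ‖x‖ ^ 2), fun t x => -1 * z t x + (0 + 0 * ‖x‖ ^ 2)])
    (f := ![_, _, _, _]) hΩ hb
    (by simp [Fin.forall_fin_succ, ha.le, hb'.le, hc.le, hd.le])
    (Fin.forall_fin_succ.2 ⟨su, Fin.forall_fin_succ.2 ⟨sv, Fin.forall_fin_succ.2 ⟨sw,
      Fin.forall_fin_succ.2 ⟨sz, fun i => i.elim0⟩⟩⟩⟩) hC0 hs ?_
    (Fin.forall_fin_succ.2 ⟨?_, Fin.forall_fin_succ.2 ⟨?_, Fin.forall_fin_succ.2 ⟨?_,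
      Fin.forall_fin_succ.2 ⟨?_, fun i => i.elim0⟩⟩⟩⟩)
  · intro x hx
    have k0 := key 0 x hx
    have k1 := key 1 x hx
    have k2 := key 2 x hx
    have k3 := key 3 x hx
    simp at k0 k1 k2 k3
    exact ⟨k0, k1, k2, k3⟩
  · intro i t ht x hx hq
    have bu : |u t x| ≤ M := (hMu t ht x hx).trans ((le_max_left _ _).trans (le_max_left _ _))
    have bv : |v t x| ≤ M := (hMv t ht x hx).trans ((le_max_right _ _).trans (le_max_left _ _))
    have bw : |w t x| ≤ M := (hMw t ht x hx).trans ((le_max_left _ _).trans (le_max_right _ _))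
    have bz : |z t x| ≤ M := (hMz t ht x hx).trans ((le_max_right _ _).trans (le_max_right _ _))
    have pu : 0 ≤ max (-u t x) 0 := le_max_right _ _
    have pv : 0 ≤ max (-v t x) 0 := le_max_right _ _
    have pw : 0 ≤ max (-w t x) 0 := le_max_right _ _
    have pz : 0 ≤ max (-z t x) 0 := le_max_right _ _
    have hle : ∀ {y k : ℝ}, 0 ≤ y → k ≤ C → k * y ≤ C * y := fun hy hk =>
      mul_le_mul_of_nonneg_right hk hy
    have e : (C * ∑ j, max ((![fun t x => -1 * u t x + (0 + 0 * ‖x‖ ^ 2),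
        fun t x => -1 * v t x + (0 + 0 * ‖x‖ ^ 2), fun t x => -1 * w t x + (0 + 0 * ‖x‖ ^ 2),
        fun t x => -1 * z t x + (0 + 0 * ‖x‖ ^ 2)] : Fin 4 → ℝ → Space N → ℝ) j t x) 0) =
        C * max (-u t x) 0 + C * max (-v t x) 0 + C * max (-w t x) 0 + C * max (-z t x) 0 := by
      simp [Fin.sum_univ_four]
      ring
    rw [e]
    have cu := mul_nonneg hC0 pu
    have cv := mul_nonneg hC0 pv
    have cw := mul_nonneg hC0 pw
    have cz := mul_nonneg hC0 pz
    fin_cases i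
    · simp at hq ⊢
      have := autocatalyst_source_neg_le (w := w t x) hα hβ hD₁ bu bv hq
      have e1 := hle pu (show M ^ 2 ≤ C by linarith)
      have e2 := hle pw (show D₁ ≤ C by linarith)
      linarith
    · simp at hq ⊢
      have := inhibitor_source_neg_le (u := u t x) (z := z t x) hβ hD₂ hq
      have e1 := hle pu (show β ≤ C by linarith)
      have e2 := hle pz (show D₂ ≤ C by linarith)
      linarith
    · simp at hq ⊢
      have := autocatalyst_source_neg_le (w := u t x) hα hβ hD₃ bw bz hq
      have e1 := hle pw (show M ^ 2 ≤ C by linarith)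
      have e2 := hle pu (show D₃ ≤ C by linarith)
      linarith
    · simp at hq ⊢
      have := inhibitor_source_neg_le (u := w t x) (z := v t x) hβ hD₄ hq
      have e1 := hle pw (show β ≤ C by linarith)
      have e2 := hle pv (show D₄ ≤ C by linarith)
      linarith
  · exact h.comp_u.tendsto_integral_posPart hT hb su.continuous_closure (ae_posPart_neg_le u hu₀)
  · exact h.comp_v.tendsto_integral_posPart hT hb sv.continuous_closure (ae_posPart_neg_le v hv₀)
  · exact h.comp_w.tendsto_integral_posPart hT hb sw.continuous_closure (ae_posPart_neg_le w hw₀)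
  · exact h.comp_z.tendsto_integral_posPart hT hb sz.continuous_closure (ae_posPart_neg_le z hz₀)

/-! ### A uniform bound for the inhibitors -/

lemma exists_ae_le_of_memLp_top {y : Space N → ℝ} (hy : MemLp y ∞ (volume.restrict Ω)) :
    ∃ C, 0 ≤ C ∧ ∀ᵐ x ∂(volume.restrict Ω), y x ≤ C := by
  refine ⟨(eLpNorm y ∞ (volume.restrict Ω)).toReal, ENNReal.toReal_nonneg, ?_⟩
  have h := ae_le_eLpNormEssSup (f := y) (μ := volume.restrict Ω)
  rw [← eLpNorm_exponent_top] at h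
  filter_upwards [h] with x hx
  have := ENNReal.toReal_mono hy.2.ne hx
  rw [toReal_enorm, Real.norm_eq_abs] at this
  exact (le_abs_self _).trans this

/-- Completing the square gives `4 v (β u - u² v) ≤ β²`, with no condition on `u`. Above the barrier
`v ≥ K ≥ 1`, so the sink `2 n κ K` produced by the paraboloid absorbs this, and the exchange term
sees only the excess of `z` over the barrier. -/
lemma inhibitor_source_le {β D κ u v z L K n : ℝ} (hD : 0 < D) (hκ : 0 < κ)
    (hn : 1 ≤ n) (hK : 1 ≤ K) (hKβ : β ^ 2 ≤ 8 * κ * K) (hL : K ≤ L) (hv : L < v) :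
    β * u - u ^ 2 * v + D * (z - v) - κ * (K * (2 * n)) ≤ D * max (z - L) 0 := by
  have h1 : D * (z - L) ≤ D * max (z - L) 0 := mul_le_mul_of_nonneg_left (le_max_left _ _) hD.le
  have h2 : D * (L - v) ≤ 0 := mul_nonpos_of_nonneg_of_nonpos hD.le (by linarith)
  have hvK : K ≤ v := hL.trans hv.le
  have hv1 : 1 ≤ v := hK.trans hvK
  have hκK : 0 < κ * K := by positivity
  have h3 : β * u - u ^ 2 * v ≤ κ * (K * (2 * n)) := by
    have e1 : 4 * v * (β * u - u ^ 2 * v) ≤ β ^ 2 := by nlinarith [sq_nonneg (β - 2 * u * v)]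
    have e2 : β ^ 2 ≤ 4 * v * (κ * (K * (2 * n))) := by
      have : 1 ≤ v * n := one_le_mul_of_one_le_of_one_le hv1 hn
      calc β ^ 2 ≤ 8 * (κ * K) * 1 := by linarith
        _ ≤ 8 * (κ * K) * (v * n) := mul_le_mul_of_nonneg_left this (by positivity)
        _ = _ := by ring
    exact le_of_mul_le_mul_left (e1.trans e2) (by linarith)
  linarith

lemma ae_posPart_sub_le {y₀ : Space N → ℝ} (y : ℝ → Space N → ℝ) (hΩ : IsOpen Ω) {K R C : ℝ}
    (hK : 0 ≤ K) (hCK : C ≤ K) (hR : ∀ x ∈ Ω, ‖x‖ ^ 2 + 1 ≤ R)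
    (hy₀ : ∀ᵐ x ∂(volume.restrict Ω), y₀ x ≤ C) :
    ∀ᵐ x ∂(volume.restrict Ω), ∀ t,
      max (1 * y t x + (-(K * R) + K * ‖x‖ ^ 2)) 0 ≤ |y t x - y₀ x| := by
  filter_upwards [hy₀, ae_restrict_mem hΩ.measurableSet] with x hx hxΩ t
  refine max_le ?_ (abs_nonneg _)
  have := mul_le_mul_of_nonneg_left (hR x hxΩ) hK
  linarith [le_abs_self (y t x - y₀ x)]

theorem IsSolution.exists_inhibitor_bound (hN : 1 ≤ N) (hΩ : IsOpen Ω)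
    (hb : Bornology.IsBounded Ω) (hb' : 0 < b) (hd : 0 < d) (hD₂ : 0 < D₂) (hD₄ : 0 < D₄)
    (hv₀ : MemLp v₀ ∞ (volume.restrict Ω)) (hz₀ : MemLp z₀ ∞ (volume.restrict Ω))
    (hT : 0 < T) (h : IsSolution Ω a b c d α β D₁ D₂ D₃ D₄ u₀ v₀ w₀ z₀ T u v w z) :
    ∃ M, 0 ≤ M ∧ ∀ s ∈ timeInterval T, ∀ x ∈ Ω, v s x ≤ M ∧ z s x ≤ M := by
  obtain ⟨Cv, hCv0, hCv⟩ := exists_ae_le_of_memLp_top hv₀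
  obtain ⟨Cz, hCz0, hCz⟩ := exists_ae_le_of_memLp_top hz₀
  obtain ⟨ρ, hρ⟩ := hb.closure.exists_norm_le
  set R := ρ ^ 2 + 1 with hRdef
  have hR : ∀ x ∈ closure Ω, ‖x‖ ^ 2 + 1 ≤ R := fun x hx => by
    have := pow_le_pow_left₀ (norm_nonneg x) (hρ x hx) 2
    linarith
  -- Large enough to dominate both initial data, to be at least `1`, and to give `β² ≤ 8 κ K` for `κ
  -- = b` and `κ = d`.
  set K := 1 + Cv + Cz + β ^ 2 / b + β ^ 2 / d with hKdef
  have hβb : 0 ≤ β ^ 2 / b := by positivity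
  have hβd : 0 ≤ β ^ 2 / d := by positivity
  have hK1 : 1 ≤ K := by linarith
  have hKb : β ^ 2 ≤ 8 * b * K := by
    have : β ^ 2 / b ≤ K := by linarith
    rw [div_le_iff₀ hb'] at this
    nlinarith
  have hKd : β ^ 2 ≤ 8 * d * K := by
    have : β ^ 2 / d ≤ K := by linarith
    rw [div_le_iff₀ hd] at this
    nlinarith
  have hn : (1 : ℝ) ≤ N := by exact_mod_cast hN
  -- The barrier is `K (R - |x|²)`: at least `K` on the closure of `Ω`, independent of time, with
  -- Laplacian `-2 N K`. A constant barrier would provide no sink.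
  obtain ⟨-, sv, -, sz⟩ := h.isSubsolution hΩ 1 (-(K * R)) K (fun x hx => by
    have := mul_le_mul_of_nonneg_left (hR x (frontier_subset_closure hx)) (by linarith : 0 ≤ K)
    linarith)
  refine ⟨K * R, by positivity, fun s hs => ?_⟩
  have key := nonpos_of_isSubsolution (ι := Fin 2) (κ := ![b, d])
    (q := ![fun t x => 1 * v t x + (-(K * R) + K * ‖x‖ ^ 2),
      fun t x => 1 * z t x + (-(K * R) + K * ‖x‖ ^ 2)])
    (f := ![_, _]) (C := D₂ + D₄) hΩ hb
    (by simp [Fin.forall_fin_succ, hb'.le, hd.le])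
    (Fin.forall_fin_succ.2 ⟨sv, Fin.forall_fin_succ.2 ⟨sz, fun i => i.elim0⟩⟩)
    (by positivity) hs ?_
    (Fin.forall_fin_succ.2 ⟨?_, Fin.forall_fin_succ.2 ⟨?_, fun i => i.elim0⟩⟩)
  · intro x hx
    have k0 := key 0 x hx
    have k1 := key 1 x hx
    simp at k0 k1
    have := mul_nonneg (by linarith : 0 ≤ K) (sq_nonneg ‖x‖)
    constructor <;> linarith
  · intro i t ht x hx hq
    set L := K * R - K * ‖x‖ ^ 2 with hL
    have hKL : K ≤ L := by
      have := mul_le_mul_of_nonneg_left (hR x (subset_closure hx)) (by linarith : 0 ≤ K)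
      linarith
    have ev : 1 * v t x + (-(K * R) + K * ‖x‖ ^ 2) = v t x - L := by rw [hL]; ring
    have ez : 1 * z t x + (-(K * R) + K * ‖x‖ ^ 2) = z t x - L := by rw [hL]; ring
    have e : ((D₂ + D₄) * ∑ j, max ((![fun t x => 1 * v t x + (-(K * R) + K * ‖x‖ ^ 2),
        fun t x => 1 * z t x + (-(K * R) + K * ‖x‖ ^ 2)] : Fin 2 → ℝ → Space N → ℝ) j t x) 0) =
        (D₂ + D₄) * (max (v t x - L) 0 + max (z t x - L) 0) := by
      rw [Fin.sum_univ_two, ← ev, ← ez]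
      rfl
    rw [e]
    have pv : 0 ≤ max (v t x - L) 0 := le_max_right _ _
    have pz : 0 ≤ max (z t x - L) 0 := le_max_right _ _
    have m1 := mul_nonneg hD₂.le pv
    have m2 := mul_nonneg hD₂.le pz
    have m3 := mul_nonneg hD₄.le pv
    have m4 := mul_nonneg hD₄.le pz
    fin_cases i
    · have hq' : 0 < 1 * v t x + (-(K * R) + K * ‖x‖ ^ 2) := hq
      rw [ev] at hq'
      have := inhibitor_source_le (u := u t x) (z := z t x) hD₂ hb' hn hK1 hKb hKL
        (by linarith : L < v t x)
      show 1 * _ - _ ≤ _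
      linarith
    · have hq' : 0 < 1 * z t x + (-(K * R) + K * ‖x‖ ^ 2) := hq
      rw [ez] at hq'
      have := inhibitor_source_le (u := w t x) (z := v t x) hD₄ hd hn hK1 hKd hKL
        (by linarith : L < z t x)
      show 1 * _ - _ ≤ _
      linarith
  · exact h.comp_v.tendsto_integral_posPart hT hb sv.continuous_closure
      (ae_posPart_sub_le v hΩ (by linarith) (by linarith)
        (fun x hx => hR x (subset_closure hx)) hCv)
  · exact h.comp_z.tendsto_integral_posPart hT hb sz.continuous_closure
      (ae_posPart_sub_le z hΩ (by linarith) (by linarith)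
        (fun x hx => hR x (subset_closure hx)) hCz)
end


/-! ### The Lyapunov density -/

lemma hasDerivAt_add_add_pow {p q : ℝ → ℝ} {p' q' t : ℝ} (hp : HasDerivAt p p' t)
    (hq : HasDerivAt q q' t) (A : ℝ) (n : ℕ) :
    HasDerivAt (fun τ => (p τ + q τ + A) ^ (n + 1))
      ((n + 1) * (p t + q t + A) ^ n * (p' + q')) t := by
  simpa using ((hp.add hq).add_const A).fun_pow (n + 1)

/-- The density `Y ^ (m + 4) + K Y ^ (m + 2) s ^ 2`, where `Y = r + s + A`. -/
def lyapunov (m : ℕ) (K A : ℝ) : Density where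
  H r s := (r + s + A) ^ (m + 4) + K * (r + s + A) ^ (m + 2) * s ^ 2
  Hr r s := (m + 4) * (r + s + A) ^ (m + 3) + K * (m + 2) * (r + s + A) ^ (m + 1) * s ^ 2
  Hs r s := (m + 4) * (r + s + A) ^ (m + 3) + K * (m + 2) * (r + s + A) ^ (m + 1) * s ^ 2 +
    2 * K * (r + s + A) ^ (m + 2) * s
  Hrr r s := (m + 4) * (m + 3) * (r + s + A) ^ (m + 2) +
    K * (m + 2) * (m + 1) * (r + s + A) ^ m * s ^ 2
  Hrs r s := (m + 4) * (m + 3) * (r + s + A) ^ (m + 2) +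
    K * (m + 2) * (m + 1) * (r + s + A) ^ m * s ^ 2 + 2 * K * (m + 2) * (r + s + A) ^ (m + 1) * s
  Hss r s := (m + 4) * (m + 3) * (r + s + A) ^ (m + 2) +
    K * (m + 2) * (m + 1) * (r + s + A) ^ m * s ^ 2 +
    2 * (2 * K * (m + 2) * (r + s + A) ^ (m + 1) * s) + 2 * K * (r + s + A) ^ (m + 2)
  partials := fun p q p' q' t hp hq => by
    have h4 := hasDerivAt_add_add_pow hp hq A (m + 3)
    have h2 := hasDerivAt_add_add_pow hp hq A (m + 1)
    refine (h4.add ((h2.const_mul K).mul (hq.fun_pow 2))).congr_deriv ?_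
    push_cast
    generalize p t + q t + A = Y
    ring
  partials_r := fun p q p' q' t hp hq => by
    have h3 := hasDerivAt_add_add_pow hp hq A (m + 2)
    have h1 := hasDerivAt_add_add_pow hp hq A m
    refine ((h3.const_mul ((m : ℝ) + 4)).add
      ((h1.const_mul (K * ((m : ℝ) + 2))).mul (hq.fun_pow 2))).congr_deriv ?_
    push_cast
    generalize p t + q t + A = Y
    ring
  partials_s := fun p q p' q' t hp hq => by
    have h3 := hasDerivAt_add_add_pow hp hq A (m + 2)
    have h2 := hasDerivAt_add_add_pow hp hq A (m + 1)
    have h1 := hasDerivAt_add_add_pow hp hq A m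
    refine (((h3.const_mul ((m : ℝ) + 4)).add
      ((h1.const_mul (K * ((m : ℝ) + 2))).mul (hq.fun_pow 2))).add
      ((h2.const_mul (2 * K)).mul hq)).congr_deriv ?_
    push_cast
    generalize p t + q t + A = Y
    ring
  continuous_H := by fun_prop
  continuous_Hr := by fun_prop
  continuous_Hs := by fun_prop
  continuous_Hrr := by fun_prop
  continuous_Hrs := by fun_prop
  continuous_Hss := by fun_prop

lemma quadratic_form_nonneg {p q r : ℝ} (hp : 0 < p) (h : q ^ 2 ≤ 4 * p * r) (ξ ζ : ℝ) :
    0 ≤ p * ξ ^ 2 + q * (ξ * ζ) + r * ζ ^ 2 := by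
  have h1 : 0 ≤ (4 * p * r - q ^ 2) * ζ ^ 2 := mul_nonneg (by linarith) (sq_nonneg _)
  have h2 : 0 ≤ 4 * p * (p * ξ ^ 2 + q * (ξ * ζ) + r * ζ ^ 2) := by
    nlinarith [sq_nonneg (2 * p * ξ + q * ζ)]
  exact nonneg_of_mul_nonneg_right h2 (by linarith)

section
variable {m : ℕ} {K A M : ℝ}

/-- Since `s` stays below `M`, a large shift `A` dominates every coefficient of the correction term.
As `A ≤ Y`, each such coefficient can be traded for a power of `Y`. The square `(M + 1)²` bounds
both `s` and `s²`. -/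
lemma shift_bounds {s : ℝ} (hK : 0 ≤ K) (hA : 2 * K * (m + 2) ^ 2 * (M + 1) ^ 2 ≤ A)
    (hs0 : 0 ≤ s) (hsM : s ≤ M) :
    K * (m + 2) * (m + 1) * s ^ 2 ≤ A ∧ 2 * K * (m + 2) * s ≤ A ∧ K * (m + 2) * s ^ 2 ≤ A ∧
      K * s ^ 2 ≤ A := by
  have hm : (0 : ℝ) ≤ m := Nat.cast_nonneg m
  have hs1 : s ≤ (M + 1) ^ 2 := by nlinarith
  have hs2 : s ^ 2 ≤ (M + 1) ^ 2 := pow_le_pow_left₀ hs0 (by linarith) 2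
  have key : ∀ c y : ℝ, 0 ≤ y → c ≤ 2 * (m + 2) ^ 2 → y ≤ (M + 1) ^ 2 → K * c * y ≤ A := by
    intro c y hy hc hyM
    calc K * c * y ≤ K * (2 * (m + 2) ^ 2) * y :=
          mul_le_mul_of_nonneg_right (mul_le_mul_of_nonneg_left hc hK) hy
      _ ≤ K * (2 * (m + 2) ^ 2) * (M + 1) ^ 2 := mul_le_mul_of_nonneg_left hyM (by positivity)
      _ = 2 * K * (m + 2) ^ 2 * (M + 1) ^ 2 := by ring
      _ ≤ A := hA
  refine ⟨?_, ?_, ?_, ?_⟩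
  · have := key ((m + 2) * (m + 1)) (s ^ 2) (sq_nonneg s) (by nlinarith) hs2
    linarith
  · have := key (2 * (m + 2)) s hs0 (by nlinarith) hs1
    linarith
  · exact key (m + 2) (s ^ 2) (sq_nonneg s) (by nlinarith) hs2
  · have := key 1 (s ^ 2) (sq_nonneg s) (by nlinarith) hs2
    linarith

/-- With `X = Y ^ (m + 2)` and `P = (m + 4)(m + 3)`, the lower-order terms are each at most `X`, so
`H_rs ≤ 2 P X`, while `H_rr ≥ P X` and `H_ss ≥ 2 K X`. The discriminant condition thus reduces to
`(a + b)² P ≤ 2 a b K`, the requirement on `K`. -/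
lemma lyapunov_dissipative {a b r s : ℝ} (ha : 0 < a) (hb : 0 < b) (hK : 0 ≤ K) (hA1 : 1 ≤ A)
    (hA : 2 * K * (m + 2) ^ 2 * (M + 1) ^ 2 ≤ A)
    (hKab : (a + b) ^ 2 * ((m + 4) * (m + 3)) ≤ 2 * (a * b) * K)
    (hr : 0 ≤ r) (hs0 : 0 ≤ s) (hsM : s ≤ M) : (lyapunov m K A).Dissipative a b r s := by
  have hm : (0 : ℝ) ≤ m := Nat.cast_nonneg m
  obtain ⟨b1, b2, -, -⟩ := shift_bounds hK hA hs0 hsM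
  set Y := r + s + A with hY
  have hAY : A ≤ Y := by linarith
  have hY1 : 1 ≤ Y := hA1.trans hAY
  have hY0 : 0 < Y := by linarith
  set X := Y ^ (m + 2) with hX
  have hX0 : 0 < X := by positivity
  set P : ℝ := (m + 4) * (m + 3) with hP
  have hP2 : 2 ≤ P := by nlinarith
  have e1 : 0 ≤ K * (m + 2) * (m + 1) * Y ^ m * s ^ 2 := by positivity
  have e1' : K * (m + 2) * (m + 1) * Y ^ m * s ^ 2 ≤ X := by
    calc K * (m + 2) * (m + 1) * Y ^ m * s ^ 2 = (K * (m + 2) * (m + 1) * s ^ 2) * Y ^ m := by ring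
      _ ≤ (Y ^ 2) * Y ^ m := mul_le_mul_of_nonneg_right
        ((b1.trans hAY).trans (le_self_pow₀ hY1 (by norm_num))) (by positivity)
      _ = X := by rw [hX]; ring
  have e2 : 0 ≤ 2 * K * (m + 2) * Y ^ (m + 1) * s := by positivity
  have e2' : 2 * K * (m + 2) * Y ^ (m + 1) * s ≤ X := by
    calc 2 * K * (m + 2) * Y ^ (m + 1) * s = (2 * K * (m + 2) * s) * Y ^ (m + 1) := by ring
      _ ≤ Y * Y ^ (m + 1) := mul_le_mul_of_nonneg_right (b2.trans hAY) (by positivity)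
      _ = X := by rw [hX]; ring
  have hrr : (lyapunov m K A).Hrr r s = P * X + K * (m + 2) * (m + 1) * Y ^ m * s ^ 2 := rfl
  have hrs : (lyapunov m K A).Hrs r s = P * X + K * (m + 2) * (m + 1) * Y ^ m * s ^ 2 +
    2 * K * (m + 2) * Y ^ (m + 1) * s := rfl
  have hss : (lyapunov m K A).Hss r s = P * X + K * (m + 2) * (m + 1) * Y ^ m * s ^ 2 +
    2 * (2 * K * (m + 2) * Y ^ (m + 1) * s) + 2 * K * X := rfl
  have hPX : 0 < P * X := by positivity
  have hPX2 : 2 * X ≤ P * X := mul_le_mul_of_nonneg_right hP2 hX0.le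
  have hKX : 0 ≤ 2 * K * X := by positivity
  refine ⟨?_, ?_, quadratic_form_nonneg ?_ ?_⟩
  · show 0 ≤ (m + 4) * Y ^ (m + 3) + K * (m + 2) * Y ^ (m + 1) * s ^ 2
    positivity
  · show 0 ≤ (m + 4) * Y ^ (m + 3) + K * (m + 2) * Y ^ (m + 1) * s ^ 2 + 2 * K * Y ^ (m + 2) * s
    positivity
  · rw [hrr]
    exact mul_pos ha (by linarith)
  · have q1 : (lyapunov m K A).Hrs r s ^ 2 ≤ (2 * (P * X)) ^ 2 := by
      rw [hrs]
      exact pow_le_pow_left₀ (by linarith) (by linarith) 2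
    have q2 : (P * X) * (2 * K * X) ≤ (lyapunov m K A).Hrr r s * (lyapunov m K A).Hss r s := by
      rw [hrr, hss]
      exact mul_le_mul (by linarith) (by linarith) hKX (by linarith)
    calc ((a + b) * (lyapunov m K A).Hrs r s) ^ 2
        = (a + b) ^ 2 * (lyapunov m K A).Hrs r s ^ 2 := by ring
      _ ≤ (a + b) ^ 2 * (2 * (P * X)) ^ 2 := mul_le_mul_of_nonneg_left q1 (sq_nonneg _)
      _ = ((a + b) ^ 2 * P) * (4 * P * X ^ 2) := by ring
      _ ≤ (2 * (a * b) * K) * (4 * P * X ^ 2) := mul_le_mul_of_nonneg_right hKab (by positivity)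
      _ = 4 * (a * b) * ((P * X) * (2 * K * X)) := by ring
      _ ≤ 4 * (a * b) * ((lyapunov m K A).Hrr r s * (lyapunov m K A).Hss r s) :=
        mul_le_mul_of_nonneg_left q2 (by positivity)
      _ = _ := by ring

lemma lyapunov_H_le {r s : ℝ} (hK : 0 ≤ K) (hA1 : 1 ≤ A)
    (hA : 2 * K * (m + 2) ^ 2 * (M + 1) ^ 2 ≤ A) (hr : 0 ≤ r) (hs0 : 0 ≤ s) (hsM : s ≤ M) :
    (lyapunov m K A).H r s ≤ 2 * (r + s + A) ^ (m + 4) := by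
  obtain ⟨-, -, -, b4⟩ := shift_bounds hK hA hs0 hsM
  show (r + s + A) ^ (m + 4) + K * (r + s + A) ^ (m + 2) * s ^ 2 ≤ _
  set Y := r + s + A with hY
  have hAY : A ≤ Y := by linarith
  have hY1 : 1 ≤ Y := hA1.trans hAY
  have : K * Y ^ (m + 2) * s ^ 2 ≤ Y ^ (m + 4) := by
    calc K * Y ^ (m + 2) * s ^ 2 = (K * s ^ 2) * Y ^ (m + 2) := by ring
      _ ≤ Y ^ 2 * Y ^ (m + 2) := mul_le_mul_of_nonneg_right
        ((b4.trans hAY).trans (le_self_pow₀ hY1 (by norm_num))) (by positivity)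
      _ = Y ^ (m + 4) := by ring
  linarith

/-- The shift gives `Y ≥ 1`, so the higher exponent `m + 4` dominates the exponent `m`. -/
lemma pow_le_lyapunov_H {r s y : ℝ} (hK : 0 ≤ K) (hA1 : 1 ≤ A) (hr : 0 ≤ r) (hs0 : 0 ≤ s)
    (hy0 : 0 ≤ y) (hy : y ≤ r + s) : y ^ m ≤ (lyapunov m K A).H r s := by
  show y ^ m ≤ (r + s + A) ^ (m + 4) + K * (r + s + A) ^ (m + 2) * s ^ 2
  set Y := r + s + A with hY
  have hY1 : 1 ≤ Y := by linarith
  have h1 : y ^ m ≤ Y ^ (m + 4) := (pow_le_pow_left₀ hy0 (by linarith) m).trans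
    (pow_le_pow_right₀ hY1 (by omega))
  have h2 : 0 ≤ K * Y ^ (m + 2) * s ^ 2 := by positivity
  linarith

/-- The production rate of the density along the reaction of one compartment, `W` being the shifted
total mass of the other compartment. -/
lemma lyapunov_reaction_le {α β D D' u v w z : ℝ} (hK : 0 ≤ K) (hA1 : 1 ≤ A)
    (hA : 2 * K * (m + 2) ^ 2 * (M + 1) ^ 2 ≤ A) (hα : 0 < α) (hD : 0 < D) (hD' : 0 < D')
    (hu : 0 ≤ u) (hv : 0 ≤ v) (hw : 0 ≤ w) (hz : 0 ≤ z) (hvM : v ≤ M) (hzM : z ≤ M) :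
    (lyapunov m K A).Hr u v * (α - (β + 1) * u + u ^ 2 * v + D * (w - u)) +
      (lyapunov m K A).Hs u v * (β * u - u ^ 2 * v + D' * (z - v)) ≤
    ((α + M + A + D * M + D' * M) * (m + 5) + 2 * K * (β ^ 2 / 4 + D' * M ^ 2) + D) *
        (u + v + A) ^ (m + 3) + D * (w + z + A) ^ (m + 3) - 4 * (u + v + A) ^ (m + 4) +
      D * (m + 4) * (((w + z + A) - (u + v + A)) * (u + v + A) ^ (m + 3)) := by
  have hm : (0 : ℝ) ≤ m := Nat.cast_nonneg m
  have hM : 0 ≤ M := hv.trans hvM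
  obtain ⟨-, -, b3, -⟩ := shift_bounds hK hA hv hvM
  have hrdef : (lyapunov m K A).Hr u v = (m + 4) * (u + v + A) ^ (m + 3) +
    K * (m + 2) * (u + v + A) ^ (m + 1) * v ^ 2 := rfl
  have hsdef : (lyapunov m K A).Hs u v = (lyapunov m K A).Hr u v +
    2 * K * (u + v + A) ^ (m + 2) * v := rfl
  set Y := u + v + A with hY
  set W := w + z + A with hW
  have hAY : A ≤ Y := by linarith
  have hY1 : 1 ≤ Y := hA1.trans hAY
  have hW1 : 1 ≤ W := by linarith
  set e := K * (m + 2) * Y ^ (m + 1) * v ^ 2 with he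
  have he0 : 0 ≤ e := by positivity
  have he1 : e ≤ Y ^ (m + 2) := by
    calc e = (K * (m + 2) * v ^ 2) * Y ^ (m + 1) := by rw [he]; ring
      _ ≤ Y * Y ^ (m + 1) := mul_le_mul_of_nonneg_right (b3.trans hAY) (by positivity)
      _ = Y ^ (m + 2) := by ring
  have hpow : Y ^ (m + 2) ≤ Y ^ (m + 3) := pow_le_pow_right₀ hY1 (by omega)
  have hY3 : 0 ≤ Y ^ (m + 3) := by positivity
  have hW3 : 0 ≤ W ^ (m + 3) := by positivity
  -- The correction part of `H_r`, multiplied by the other compartment's mass, has total degree `m +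
  -- 3`; comparing `W` with `Y` splits it into pure powers.
  have hWe : W * e ≤ Y ^ (m + 3) + W ^ (m + 3) := by
    have h1 : W * e ≤ W * Y ^ (m + 2) := mul_le_mul_of_nonneg_left he1 (by linarith)
    rcases le_total W Y with h | h
    · have : W * Y ^ (m + 2) ≤ Y * Y ^ (m + 2) := mul_le_mul_of_nonneg_right h (by positivity)
      have e1 : Y * Y ^ (m + 2) = Y ^ (m + 3) := by ring
      linarith
    · have : W * Y ^ (m + 2) ≤ W * W ^ (m + 2) :=
        mul_le_mul_of_nonneg_left (pow_le_pow_left₀ (by linarith) h _) (by linarith)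
      have e1 : W * W ^ (m + 2) = W ^ (m + 3) := by ring
      linarith
  set C₂ := α + M + A + D * M + D' * M with hC₂
  have hC₂0 : 0 ≤ C₂ := by positivity
  have hr0 : 0 ≤ (lyapunov m K A).Hr u v := by rw [hrdef]; positivity
  -- the total mass
  have hsum : α - u + D * (w - u) + D' * (z - v) ≤ C₂ - Y + D * (W - Y) := by
    have e1 : D * v ≤ D * M := mul_le_mul_of_nonneg_left hvM hD.le
    have e2 : D' * z ≤ D' * M := mul_le_mul_of_nonneg_left hzM hD'.le
    have e3 : 0 ≤ D' * v := by positivity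
    have e4 : 0 ≤ D * z := by positivity
    rw [hC₂, hY, hW]
    linarith
  have hmass : (lyapunov m K A).Hr u v * (α - u + D * (w - u) + D' * (z - v)) ≤
      C₂ * (m + 5) * Y ^ (m + 3) - 4 * Y ^ (m + 4) + D * (m + 4) * ((W - Y) * Y ^ (m + 3)) +
        D * (Y ^ (m + 3) + W ^ (m + 3)) := by
    refine (mul_le_mul_of_nonneg_left hsum hr0).trans ?_
    have t1 : C₂ * (lyapunov m K A).Hr u v ≤ C₂ * ((m + 5) * Y ^ (m + 3)) := by
      refine mul_le_mul_of_nonneg_left ?_ hC₂0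
      rw [hrdef]
      linarith
    -- The damping `-Y` times the leading coefficient `m + 4`, weakened to `4`: later two units
    -- absorb `H`, one absorbs the terms of degree `m + 3`, and one is spare.
    have t2 : 4 * Y ^ (m + 4) ≤ Y * (lyapunov m K A).Hr u v := by
      have s1 : 4 * Y ^ (m + 3) ≤ (lyapunov m K A).Hr u v := by
        have : 0 ≤ (m : ℝ) * Y ^ (m + 3) := by positivity
        rw [hrdef]
        linarith
      calc 4 * Y ^ (m + 4) = Y * (4 * Y ^ (m + 3)) := by ring
        _ ≤ _ := mul_le_mul_of_nonneg_left s1 (by linarith)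
    have t3 : D * ((W - Y) * (lyapunov m K A).Hr u v) ≤
        D * (m + 4) * ((W - Y) * Y ^ (m + 3)) + D * (Y ^ (m + 3) + W ^ (m + 3)) := by
      have s1 : 0 ≤ Y * e := by positivity
      have s2 : D * (W * e - Y * e) ≤ D * (Y ^ (m + 3) + W ^ (m + 3)) :=
        mul_le_mul_of_nonneg_left (by linarith) hD.le
      rw [hrdef]
      linarith
    linarith
  -- the exchange between the two species of the compartment
  have hexch : 2 * K * Y ^ (m + 2) * v * (β * u - u ^ 2 * v + D' * (z - v)) ≤
      2 * K * (β ^ 2 / 4 + D' * M ^ 2) * Y ^ (m + 3) := by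
    have s1 : v * (β * u - u ^ 2 * v + D' * (z - v)) ≤ β ^ 2 / 4 + D' * M ^ 2 := by
      have q1 : v * z ≤ M ^ 2 := by
        rw [sq]
        exact mul_le_mul hvM hzM hz hM
      have q2 : D' * (v * z) ≤ D' * M ^ 2 := mul_le_mul_of_nonneg_left q1 hD'.le
      have q3 : 0 ≤ D' * v ^ 2 := by positivity
      -- This square is `β u v - u² v² ≤ β² / 4`: the weight `v` makes the cubic consumption control
      -- the production.
      have q4 := sq_nonneg (u * v - β / 2)
      linarith
    have s2 : 0 ≤ 2 * K * Y ^ (m + 2) := by positivity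
    have s3 : 0 ≤ 2 * K * (β ^ 2 / 4 + D' * M ^ 2) := by positivity
    calc _ = 2 * K * Y ^ (m + 2) * (v * (β * u - u ^ 2 * v + D' * (z - v))) := by ring
      _ ≤ 2 * K * Y ^ (m + 2) * (β ^ 2 / 4 + D' * M ^ 2) := mul_le_mul_of_nonneg_left s1 s2
      _ = 2 * K * (β ^ 2 / 4 + D' * M ^ 2) * Y ^ (m + 2) := by ring
      _ ≤ _ := mul_le_mul_of_nonneg_left hpow s3
  -- Writing `H_s = H_r + 2 K Y ^ (m + 2) v`, the common factor `H_r` multiplies the sum of the two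
  -- reactions, in which both `β u` and `u² v` cancel.
  calc _ = (lyapunov m K A).Hr u v * (α - u + D * (w - u) + D' * (z - v)) +
      2 * K * Y ^ (m + 2) * v * (β * u - u ^ 2 * v + D' * (z - v)) := by rw [hsdef]; ring
    _ ≤ _ := add_le_add hmass hexch
    _ = _ := by ring

lemma mul_pow_le_pow_add_pow {C Y : ℝ} (hC : 0 ≤ C) (hY : 0 ≤ Y) (n : ℕ) :
    C * Y ^ n ≤ Y ^ (n + 1) + C ^ (n + 1) := by
  have h1 : 0 ≤ Y ^ (n + 1) := by positivity
  have h2 : 0 ≤ C ^ (n + 1) := by positivity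
  rcases le_total C Y with h | h
  · have := mul_le_mul_of_nonneg_right h (pow_nonneg hY n)
    have e : Y * Y ^ n = Y ^ (n + 1) := by ring
    linarith
  · have := mul_le_mul_of_nonneg_left (pow_le_pow_left₀ hY h n) hC
    have e : C * C ^ n = C ^ (n + 1) := by ring
    linarith

lemma sub_mul_pow_add_sub_mul_pow_nonpos {Y W : ℝ} (hY : 0 ≤ Y) (hW : 0 ≤ W) (n : ℕ) :
    (W - Y) * Y ^ n + (Y - W) * W ^ n ≤ 0 := by
  rcases le_total Y W with h | h
  · have := pow_le_pow_left₀ hY h n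
    nlinarith
  · have := pow_le_pow_left₀ hW h n
    nlinarith

/-- Total production of the weighted sum of the densities of the two compartments. -/
lemma exists_lyapunov_production_le {α β D₁ D₂ D₃ D₄ : ℝ} (hK : 0 ≤ K) (hA1 : 1 ≤ A) (hM : 0 ≤ M)
    (hA : 2 * K * (m + 2) ^ 2 * (M + 1) ^ 2 ≤ A) (hα : 0 < α)
    (hD₁ : 0 < D₁) (hD₂ : 0 < D₂) (hD₃ : 0 < D₃) (hD₄ : 0 < D₄) :
    ∃ C : ℝ, ∀ u v w z : ℝ, 0 ≤ u → 0 ≤ v → 0 ≤ w → 0 ≤ z → v ≤ M → z ≤ M →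
      D₃ * ((lyapunov m K A).Hr u v * (α - (β + 1) * u + u ^ 2 * v + D₁ * (w - u)) +
        (lyapunov m K A).Hs u v * (β * u - u ^ 2 * v + D₂ * (z - v))) +
      D₁ * ((lyapunov m K A).Hr w z * (α - (β + 1) * w + w ^ 2 * z + D₃ * (u - w)) +
        (lyapunov m K A).Hs w z * (β * w - w ^ 2 * z + D₄ * (v - z))) ≤
      C - (D₃ * (lyapunov m K A).H u v + D₁ * (lyapunov m K A).H w z) := by
  set C₁ := (α + M + A + D₁ * M + D₂ * M) * (m + 5) + 2 * K * (β ^ 2 / 4 + D₂ * M ^ 2) + D₁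
    with hC₁
  set C₂ := (α + M + A + D₃ * M + D₄ * M) * (m + 5) + 2 * K * (β ^ 2 / 4 + D₄ * M ^ 2) + D₃
    with hC₂
  have hC₁0 : 0 ≤ C₁ := by positivity
  have hC₂0 : 0 ≤ C₂ := by positivity
  refine ⟨D₃ * (C₁ + D₁) ^ (m + 4) + D₁ * (C₂ + D₃) ^ (m + 4), fun u v w z hu hv hw hz hvM hzM => ?_⟩
  have r1 := lyapunov_reaction_le (β := β) hK hA1 hA hα hD₁ hD₂ hu hv hw hz hvM hzM
  have r2 := lyapunov_reaction_le (β := β) hK hA1 hA hα hD₃ hD₄ hw hz hu hv hzM hvM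
  have k1 := lyapunov_H_le hK hA1 hA hu hv hvM
  have k2 := lyapunov_H_le hK hA1 hA hw hz hzM
  rw [← hC₁] at r1
  rw [← hC₂] at r2
  set Y := u + v + A
  set W := w + z + A
  have hY0 : 0 ≤ Y := by positivity
  have hW0 : 0 ≤ W := by positivity
  -- Adding `D₁` to `C₁` leaves a surplus `-D₁ Y ^ (m + 3)`. After weighting, the differences `W ^
  -- (m + 3) - Y ^ (m + 3)` from the two compartments cancel.
  have y1 := mul_pow_le_pow_add_pow (add_nonneg hC₁0 hD₁.le) hY0 (m + 3)
  have y2 := mul_pow_le_pow_add_pow (add_nonneg hC₂0 hD₃.le) hW0 (m + 3)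
  have x1 := sub_mul_pow_add_sub_mul_pow_nonpos hY0 hW0 (m + 3)
  -- The exchange carries `D₁` in the first compartment and `D₃` in the second; the weights `D₃` and
  -- `D₁` equalize them, and monotonicity of powers gives the sign.
  have hcross : D₁ * D₃ * (m + 4) * ((W - Y) * Y ^ (m + 3) + (Y - W) * W ^ (m + 3)) ≤ 0 :=
    mul_nonpos_of_nonneg_of_nonpos (by positivity) x1
  have hYp : 0 ≤ D₃ * Y ^ (m + 4) := by positivity
  have hWp : 0 ≤ D₁ * W ^ (m + 4) := by positivity
  simp only [show m + 3 + 1 = m + 4 from rfl] at y1 y2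
  -- The powers and the production rates become opaque atoms, leaving a linear combination of the
  -- collected inequalities.
  clear_value C₁ C₂ Y W
  generalize (lyapunov m K A).Hr u v * _ + _ = X₁ at r1 ⊢
  generalize (lyapunov m K A).Hr w z * _ + _ = X₂ at r2 ⊢
  generalize (C₁ + D₁) ^ (m + 4) = P₁ at y1 ⊢
  generalize (C₂ + D₃) ^ (m + 4) = P₂ at y2 ⊢
  generalize Y ^ (m + 3) = Y₃ at *
  generalize W ^ (m + 3) = W₃ at *
  generalize Y ^ (m + 4) = Y₄ at *
  generalize W ^ (m + 4) = W₄ at *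
  have s1 := mul_le_mul_of_nonneg_left (show X₁ + (lyapunov m K A).H u v ≤
    P₁ + D₁ * (W₃ - Y₃) + D₁ * (m + 4) * ((W - Y) * Y₃) - Y₄ by linarith) hD₃.le
  have s2 := mul_le_mul_of_nonneg_left (show X₂ + (lyapunov m K A).H w z ≤
    P₂ + D₃ * (Y₃ - W₃) + D₃ * (m + 4) * ((Y - W) * W₃) - W₄ by linarith) hD₁.le
  linarith
end


/-! ### Membership in `L^∞(0, T; L^n(Ω))` -/

section
variable {N : ℕ} {Ω : Set (Space N)} {T : EReal}

lemma isOpen_timeInterval (T : EReal) : IsOpen (timeInterval T) :=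
  (isOpen_lt continuous_const continuous_id).inter
    (isOpen_lt continuous_coe_real_ereal continuous_const)

lemma memLp_of_continuousOn_closure (hΩ : IsOpen Ω) (hb : Bornology.IsBounded Ω)
    {f : Space N → ℝ} (hf : ContinuousOn f (closure Ω)) (p : ℝ≥0∞) :
    MemLp f p (volume.restrict Ω) := by
  have : IsFiniteMeasure ((volume : Measure (Space N)).restrict Ω) :=
    ⟨by simpa using hb.measure_lt_top⟩
  obtain ⟨C, hC⟩ := hb.isCompact_closure.exists_bound_of_continuousOn hf
  refine MemLp.of_bound (integrableOn_of_continuousOn_closure hb hf).1 C ?_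
  filter_upwards [ae_restrict_mem hΩ.measurableSet] with x hx using hC x (subset_closure hx)

open Classical in
/-- The curve `t ↦ q(t)` in `L^p(Ω)`, with value `0` where `q(t)` does not belong to `L^p(Ω)`. -/
noncomputable def lpCurve (Ω : Set (Space N)) (p : ℝ≥0∞) (q : ℝ → Space N → ℝ) (t : ℝ) :
    Lp ℝ p ((volume : Measure (Space N)).restrict Ω) :=
  if h : MemLp (q t) p (volume.restrict Ω) then h.toLp else 0

lemma coeFn_lpCurve {p : ℝ≥0∞} {q : ℝ → Space N → ℝ} {t : ℝ}
    (h : MemLp (q t) p (volume.restrict Ω)) :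
    lpCurve Ω p q t =ᵐ[volume.restrict Ω] q t := by
  rw [lpCurve, dif_pos h]
  exact h.coeFn_toLp

/-- Uniform continuity of `q` on a compact time neighbourhood times the closure of `Ω` makes `t ↦ q
t` continuous in the supremum norm, hence in `L^p` on a set of finite measure. It supplies the
strong measurability of the curve. -/
lemma continuousOn_lpCurve (hΩ : IsOpen Ω) (hb : Bornology.IsBounded Ω) (p : ℝ≥0∞)
    [Fact (1 ≤ p)] {q : ℝ → Space N → ℝ}
    (hq : ContinuousOn (fun x : ℝ × Space N => q x.1 x.2) (timeInterval T ×ˢ closure Ω)) :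
    ContinuousOn (lpCurve Ω p q) (timeInterval T) := by
  have : IsFiniteMeasure ((volume : Measure (Space N)).restrict Ω) :=
    ⟨by simpa using hb.measure_lt_top⟩
  intro t₀ ht₀
  refine ContinuousAt.continuousWithinAt ?_
  obtain ⟨r, hr, hball⟩ := Metric.isOpen_iff.1 (isOpen_timeInterval T) t₀ ht₀
  have hsub : Metric.closedBall t₀ (r / 2) ⊆ timeInterval T :=
    (Metric.closedBall_subset_ball (by linarith)).trans hball
  have hunif := ((isCompact_closedBall t₀ (r / 2)).prod
    hb.isCompact_closure).uniformContinuousOn_of_continuous (hq.mono (prod_mono_left hsub))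
  rw [Metric.uniformContinuousOn_iff] at hunif
  set V : ℝ := ((volume.restrict Ω : Measure (Space N)) univ).toReal ^ p.toReal⁻¹ with hV
  have hV0 : 0 ≤ V := Real.rpow_nonneg ENNReal.toReal_nonneg _
  rw [Metric.continuousAt_iff]
  intro ε hε
  obtain ⟨δ, hδ, hδq⟩ := hunif (ε / (V + 1)) (by positivity)
  refine ⟨min δ (r / 2), lt_min hδ (by linarith), fun t ht => ?_⟩
  have htb : t ∈ Metric.closedBall t₀ (r / 2) := (ht.trans_le (min_le_right _ _)).le
  have ht₀b : t₀ ∈ Metric.closedBall t₀ (r / 2) := Metric.mem_closedBall_self (by linarith)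
  have m1 := memLp_of_continuousOn_closure hΩ hb (continuousOn_slice hq (hsub htb)) p
  have m2 := memLp_of_continuousOn_closure hΩ hb (continuousOn_slice hq ht₀) p
  rw [dist_eq_norm]
  have hle : ‖lpCurve Ω p q t - lpCurve Ω p q t₀‖ ≤ V * (ε / (V + 1)) := by
    refine Lp.norm_le_of_ae_bound (by positivity) ?_
    filter_upwards [Lp.coeFn_sub (lpCurve Ω p q t) (lpCurve Ω p q t₀), coeFn_lpCurve m1,
      coeFn_lpCurve m2, ae_restrict_mem hΩ.measurableSet] with x h1 h2 h3 hx
    rw [h1, Pi.sub_apply, h2, h3, ← dist_eq_norm]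
    refine (hδq (t, x) ⟨htb, subset_closure hx⟩ (t₀, x) ⟨ht₀b, subset_closure hx⟩ ?_).le
    rw [Prod.dist_eq, dist_self, max_eq_left dist_nonneg]
    exact ht.trans_le (min_le_left _ _)
  refine hle.trans_lt ?_
  rw [mul_div_assoc', div_lt_iff₀ (by linarith)]
  nlinarith

lemma memLinftyLp_of_integral_pow_le (hΩ : IsOpen Ω) (hb : Bornology.IsBounded Ω) (n : ℕ)
    [hn : Fact (1 ≤ (n : ℝ≥0∞))] {q : ℝ → Space N → ℝ}
    (hq : ContinuousOn (fun x : ℝ × Space N => q x.1 x.2) (timeInterval T ×ˢ closure Ω))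
    (hq0 : ∀ t ∈ timeInterval T, ∀ x ∈ Ω, 0 ≤ q t x) {B : ℝ}
    (hB : ∀ t ∈ timeInterval T, ∫ x in Ω, q t x ^ n ≤ B) : MemLinftyLp Ω T n q := by
  have hn0 : (n : ℝ≥0∞) ≠ 0 := (zero_lt_one.trans_le hn.out).ne'
  have hmem : ∀ t ∈ timeInterval T, MemLp (q t) n (volume.restrict Ω) := fun t ht =>
    memLp_of_continuousOn_closure hΩ hb (continuousOn_slice hq ht) n
  have hmeas : MeasurableSet (timeInterval T) := (isOpen_timeInterval T).measurableSet
  refine ⟨lpCurve Ω n q, ?_, ?_⟩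
  · refine memLp_top_of_bound ((continuousOn_lpCurve hΩ hb n hq).aestronglyMeasurable hmeas)
      (B ^ (n : ℝ)⁻¹) ?_
    filter_upwards [ae_restrict_mem hmeas] with t ht
    have h := hmem t ht
    have hint : ∫ x in Ω, ‖q t x‖ ^ (n : ℝ) = ∫ x in Ω, q t x ^ n := by
      refine setIntegral_congr_fun hΩ.measurableSet fun x hx => ?_
      simp only [Real.norm_of_nonneg (hq0 t ht x hx), Real.rpow_natCast]
    rw [lpCurve, dif_pos h, Lp.norm_toLp,
      h.eLpNorm_eq_integral_rpow_norm hn0 (ENNReal.natCast_ne_top n), ENNReal.toReal_natCast, hint]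
    have hnn : 0 ≤ ∫ x in Ω, q t x ^ n :=
      setIntegral_nonneg hΩ.measurableSet fun x hx => pow_nonneg (hq0 t ht x hx) n
    rw [ENNReal.toReal_ofReal (Real.rpow_nonneg hnn _)]
    exact Real.rpow_le_rpow hnn (hB t ht) (by positivity)
  · filter_upwards [ae_restrict_mem hmeas] with t ht using coeFn_lpCurve (hmem t ht)

lemma exists_mem_timeInterval (hT : 0 < T) : ∃ s, s ∈ timeInterval T := by
  obtain ⟨s, hs0, hsT⟩ := EReal.lt_iff_exists_real_btwn.1 hT
  exact ⟨s, by exact_mod_cast hs0, hsT⟩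

/-- With rate `-1` the bound does not depend on the elapsed time, so it also serves on an infinite
interval. -/
lemma gronwallBound_neg_one_le {δ ε x : ℝ} (hδ : 0 ≤ δ) (hε : 0 ≤ ε) (hx : 0 ≤ x) :
    gronwallBound δ (-1) ε x ≤ δ + ε := by
  rw [gronwallBound_of_K_ne_0 (by norm_num)]
  have h1 : Real.exp (-1 * x) ≤ 1 := Real.exp_le_one_iff.2 (by linarith)
  have h2 := Real.exp_pos (-1 * x)
  have h3 : δ * Real.exp (-1 * x) ≤ δ := mul_le_of_le_one_right hδ h1
  have h4 : 0 ≤ ε * Real.exp (-1 * x) := by positivity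
  have h5 : ε / -1 = -ε := by ring
  simp only [h5]
  linarith

variable {a b c d α β D₁ D₂ D₃ D₄ : ℝ} {u₀ v₀ w₀ z₀ : Space N → ℝ} {u v w z : ℝ → Space N → ℝ}

/-- The energy of one compartment with activator `u` and inhibitor `v`. -/
noncomputable def compartmentEnergy (Ω : Set (Space N)) (D : Density) (u v : ℝ → Space N → ℝ)
    (t : ℝ) : ℝ := ∫ x in Ω, D.H (u t x) (v t x)

/-- The energy inequality for one compartment of the system. -/
lemma compartmentEnergy_sub_le (hΩ : IsOpen Ω) (hb : Bornology.IsBounded Ω) {t₀ t₁ : ℝ}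
    (h01 : t₀ ≤ t₁) (ha : 0 < a) (hb' : 0 < b) (hα : 0 < α) (hβ : 0 < β) (hD₁ : 0 < D₁)
    (hD₂ : 0 < D₂) (D : Density)
    (su : IsSubsolution Ω (Icc t₀ t₁) a u fun t x =>
      α - (β + 1) * u t x + u t x ^ 2 * v t x + D₁ * (w t x - u t x))
    (sv : IsSubsolution Ω (Icc t₀ t₁) b v fun t x =>
      β * u t x - u t x ^ 2 * v t x + D₂ * (z t x - v t x))
    {M : ℝ} (hpos : ∀ t ∈ Icc t₀ t₁, ∀ x ∈ Ω, 0 ≤ u t x ∧ 0 ≤ v t x ∧ 0 ≤ w t x ∧ 0 ≤ z t x)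
    (hM : ∀ t ∈ Icc t₀ t₁, ∀ x ∈ Ω, v t x ≤ M)
    (hD : ∀ r s, 0 ≤ r → 0 ≤ s → s ≤ M → D.Dissipative a b r s) :
    compartmentEnergy Ω D u v t₁ - compartmentEnergy Ω D u v t₀ ≤ ∫ t in Ioc t₀ t₁, ∫ x in Ω,
      (D.Hr (u t x) (v t x) * (α - (β + 1) * u t x + u t x ^ 2 * v t x + D₁ * (w t x - u t x)) +
        D.Hs (u t x) (v t x) * (β * u t x - u t x ^ 2 * v t x + D₂ * (z t x - v t x))) := by
  have hmax : ∀ t ∈ Icc t₀ t₁, ∀ x ∈ Ω, max (u t x) 0 = u t x ∧ max (v t x) 0 = v t x :=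
    fun t ht x hx => ⟨max_eq_left (hpos t ht x hx).1, max_eq_left (hpos t ht x hx).2.1⟩
  have hE : ∀ t ∈ Icc t₀ t₁, ∫ x in Ω, D.H (max (u t x) 0) (max (v t x) 0) =
      compartmentEnergy Ω D u v t := fun t ht =>
    setIntegral_congr_fun hΩ.measurableSet fun x hx => by
      simp only [(hmax t ht x hx).1, (hmax t ht x hx).2]
  have cu := su.continuous_closure
  have cv := sv.continuous_closure
  have := energy_le hΩ hb h01 ha.le hb'.le (ρ := fun t x => D.Hr (u t x) (v t x) *
      (α - (β + 1) * u t x + u t x ^ 2 * v t x + D₁ * (w t x - u t x)) +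
    D.Hs (u t x) (v t x) * (β * u t x - u t x ^ 2 * v t x + D₂ * (z t x - v t x))) D su sv
    (fun t ht x hx r s hr _ hs hs' => hD r s hr hs
      (hs'.trans ((hmax t ht x hx).2.trans_le (hM t ht x hx))))
    (((continuousOn_comp₂ D.continuous_Hr cu cv).mul su.continuous_source).add
      ((continuousOn_comp₂ D.continuous_Hs cu cv).mul sv.continuous_source))
    (fun t ht x hx => by
      obtain ⟨pu, pv, pw, pz⟩ := hpos t ht x hx
      have hdis := hD _ _ pu pv (hM t ht x hx)
      rw [(hmax t ht x hx).1, (hmax t ht x hx).2]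
      refine add_le_add ?_ ?_
      -- The indicators can be dropped: where `u = 0` the source is `α + D₁ w ≥ 0`, where `v = 0` it
      -- is `β u + D₂ z ≥ 0`, and the gradient of `D` is nonnegative there.
      · split_ifs with h
        · rw [mul_one]
        · have h0 : u t x = 0 := le_antisymm (not_lt.1 h) pu
          rw [mul_zero, zero_mul]
          refine mul_nonneg hdis.Hr_nonneg ?_
          rw [h0]
          have := mul_nonneg hD₁.le pw
          linarith
      · split_ifs with h
        · rw [mul_one]
        · have h0 : v t x = 0 := le_antisymm (not_lt.1 h) pv
          rw [mul_zero, zero_mul]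
          refine mul_nonneg hdis.Hs_nonneg ?_
          rw [h0]
          have := mul_nonneg hD₂.le pz
          have := mul_nonneg hβ.le pu
          linarith)
  rwa [hE t₁ ⟨h01, le_rfl⟩, hE t₀ ⟨le_rfl, h01⟩] at this

lemma compartmentEnergy_le (hΩ : IsOpen Ω) (hb : Bornology.IsBounded Ω) {D : Density} {t R C : ℝ}
    (hu : ContinuousOn (u t) (closure Ω)) (hv : ContinuousOn (v t) (closure Ω))
    (hC : ∀ r s, 0 ≤ r → r ≤ R → 0 ≤ s → s ≤ R → |D.H r s| ≤ C)
    (hpos : ∀ x ∈ Ω, 0 ≤ u t x ∧ 0 ≤ v t x) (hR : ∀ x ∈ Ω, u t x ≤ R ∧ v t x ≤ R) :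
    compartmentEnergy Ω D u v t ≤ C * volume.real Ω := by
  have := setIntegral_mono_on (μ := volume) (f := fun x => D.H (u t x) (v t x)) (g := fun _ => C)
    (integrableOn_of_continuousOn_closure hb (continuousOn_comp₂ D.continuous_H hu hv))
    (integrableOn_const hb.measure_lt_top.ne) hΩ.measurableSet fun x hx =>
      (le_abs_self _).trans (hC _ _ (hpos x hx).1 (hR x hx).1 (hpos x hx).2 (hR x hx).2)
  rwa [setIntegral_const, smul_eq_mul, mul_comm] at this

/-- The uniform bound for the weighted energy. -/
lemma IsSolution.exists_energy_bound (hΩ : IsOpen Ω) (hb : Bornology.IsBounded Ω)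
    (ha : 0 < a) (hb' : 0 < b) (hc : 0 < c) (hd : 0 < d) (hα : 0 < α) (hβ : 0 < β)
    (hD₁ : 0 < D₁) (hD₂ : 0 < D₂) (hD₃ : 0 < D₃) (hD₄ : 0 < D₄) (hT : 0 < T)
    (h : IsSolution Ω a b c d α β D₁ D₂ D₃ D₄ u₀ v₀ w₀ z₀ T u v w z)
    (hpos : ∀ t ∈ timeInterval T, ∀ x ∈ Ω, 0 ≤ u t x ∧ 0 ≤ v t x ∧ 0 ≤ w t x ∧ 0 ≤ z t x)
    {M : ℝ} (hM : ∀ t ∈ timeInterval T, ∀ x ∈ Ω, v t x ≤ M ∧ z t x ≤ M) (D : Density)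
    (hH : ∀ r s, 0 ≤ r → 0 ≤ s → 0 ≤ D.H r s)
    (hDab : ∀ r s, 0 ≤ r → 0 ≤ s → s ≤ M → D.Dissipative a b r s)
    (hDcd : ∀ r s, 0 ≤ r → 0 ≤ s → s ≤ M → D.Dissipative c d r s)
    (hprod : ∃ C : ℝ, ∀ u v w z : ℝ, 0 ≤ u → 0 ≤ v → 0 ≤ w → 0 ≤ z → v ≤ M → z ≤ M →
      D₃ * (D.Hr u v * (α - (β + 1) * u + u ^ 2 * v + D₁ * (w - u)) +
        D.Hs u v * (β * u - u ^ 2 * v + D₂ * (z - v))) +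
      D₁ * (D.Hr w z * (α - (β + 1) * w + w ^ 2 * z + D₃ * (u - w)) +
        D.Hs w z * (β * w - w ^ 2 * z + D₄ * (v - z))) ≤
      C - (D₃ * D.H u v + D₁ * D.H w z)) :
    ∃ B, ∀ t ∈ timeInterval T,
      D₃ * compartmentEnergy Ω D u v t + D₁ * compartmentEnergy Ω D w z t ≤ B := by
  obtain ⟨C, hC⟩ := hprod
  obtain ⟨s, hs⟩ := exists_mem_timeInterval hT
  obtain ⟨Mu, hMu⟩ := h.comp_u.locally_bounded s hs
  obtain ⟨Mv, hMv⟩ := h.comp_v.locally_bounded s hs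
  obtain ⟨Mw, hMw⟩ := h.comp_w.locally_bounded s hs
  obtain ⟨Mz, hMz⟩ := h.comp_z.locally_bounded s hs
  have cu := h.comp_u.continuous_closure
  have cv := h.comp_v.continuous_closure
  have cw := h.comp_w.continuous_closure
  have cz := h.comp_z.continuous_closure
  set R := max (max Mu Mv) (max Mw Mz) with hR
  obtain ⟨CH, hCH0, hCH⟩ := exists_bound_on_box D.continuous_H R
  set F : ℝ → ℝ := fun t => D₃ * compartmentEnergy Ω D u v t + D₁ * compartmentEnergy Ω D w z t
    with hF
  set B₀ := D₃ * (CH * volume.real Ω) + D₁ * (CH * volume.real Ω) with hB₀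
  have hV : 0 ≤ volume.real Ω := measureReal_nonneg
  have hB₀0 : 0 ≤ B₀ := by positivity
  -- Up to a fixed time `s` the energy is controlled by the assumed local bound on the solution;
  -- Gronwall is needed only from `s` onwards, away from the initial time.
  have hsmall : ∀ t ∈ Ioc 0 s, F t ≤ B₀ := by
    intro t ht
    have htT : t ∈ timeInterval T := Icc_subset_timeInterval ht.1 hs ⟨le_rfl, ht.2⟩
    have e1 := compartmentEnergy_le hΩ hb (continuousOn_slice cu htT) (continuousOn_slice cv htT)
      hCH (fun x hx => ⟨(hpos t htT x hx).1, (hpos t htT x hx).2.1⟩) fun x hx =>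
        ⟨((le_abs_self _).trans (hMu t ht x hx)).trans ((le_max_left _ _).trans (le_max_left _ _)),
        ((le_abs_self _).trans (hMv t ht x hx)).trans ((le_max_right _ _).trans (le_max_left _ _))⟩
    have e2 := compartmentEnergy_le hΩ hb (continuousOn_slice cw htT) (continuousOn_slice cz htT)
      hCH (fun x hx => (hpos t htT x hx).2.2) fun x hx =>
        ⟨((le_abs_self _).trans (hMw t ht x hx)).trans ((le_max_left _ _).trans (le_max_right _ _)),
        ((le_abs_self _).trans (hMz t ht x hx)).trans ((le_max_right _ _).trans (le_max_right _ _))⟩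
    exact add_le_add (mul_le_mul_of_nonneg_left e1 hD₃.le) (mul_le_mul_of_nonneg_left e2 hD₁.le)
  refine ⟨B₀ + |C| * volume.real Ω, fun t ht => ?_⟩
  show F t ≤ _
  have hCV : 0 ≤ |C| * volume.real Ω := by positivity
  rcases le_total t s with hts | hst
  · linarith [hsmall t ⟨ht.1, hts⟩]
  have hJ : Icc s t ⊆ timeInterval T := Icc_subset_timeInterval hs.1 ht
  obtain ⟨su, sv, sw, sz⟩ := h.isSubsolution hΩ 1 0 0 (by simp)
  simp only [one_mul, zero_mul, mul_zero, add_zero, sub_zero] at su sv sw sz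
  set ρ₁ : ℝ → Space N → ℝ := fun t x => D.Hr (u t x) (v t x) *
      (α - (β + 1) * u t x + u t x ^ 2 * v t x + D₁ * (w t x - u t x)) +
    D.Hs (u t x) (v t x) * (β * u t x - u t x ^ 2 * v t x + D₂ * (z t x - v t x)) with hρ₁
  set ρ₂ : ℝ → Space N → ℝ := fun t x => D.Hr (w t x) (z t x) *
      (α - (β + 1) * w t x + w t x ^ 2 * z t x + D₃ * (u t x - w t x)) +
    D.Hs (w t x) (z t x) * (β * w t x - w t x ^ 2 * z t x + D₄ * (v t x - z t x)) with hρ₂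
  have cρ₁ : ContinuousOn (fun p : ℝ × Space N => ρ₁ p.1 p.2) (timeInterval T ×ˢ closure Ω) :=
    ((continuousOn_comp₂ D.continuous_Hr cu cv).mul su.continuous_source).add
      ((continuousOn_comp₂ D.continuous_Hs cu cv).mul sv.continuous_source)
  have cρ₂ : ContinuousOn (fun p : ℝ × Space N => ρ₂ p.1 p.2) (timeInterval T ×ˢ closure Ω) :=
    ((continuousOn_comp₂ D.continuous_Hr cw cz).mul sw.continuous_source).add
      ((continuousOn_comp₂ D.continuous_Hs cw cz).mul sz.continuous_source)
  have cH₁ : ContinuousOn (fun p : ℝ × Space N => D.H (u p.1 p.2) (v p.1 p.2))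
      (timeInterval T ×ˢ closure Ω) := continuousOn_comp₂ D.continuous_H cu cv
  have cH₂ : ContinuousOn (fun p : ℝ × Space N => D.H (w p.1 p.2) (z p.1 p.2))
      (timeInterval T ×ˢ closure Ω) := continuousOn_comp₂ D.continuous_H cw cz
  have hJs := prod_mono_left (t := closure Ω) hJ
  have cF : ContinuousOn F (Icc s t) :=
    (continuousOn_const.mul (continuousOn_setIntegral_slice hb
      (F := fun t x => D.H (u t x) (v t x)) (cH₁.mono hJs))).add
    (continuousOn_const.mul (continuousOn_setIntegral_slice hb
      (F := fun t x => D.H (w t x) (z t x)) (cH₂.mono hJs)))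
  have ci₁ := continuousOn_setIntegral_slice hb (F := ρ₁) (cρ₁.mono hJs)
  have ci₂ := continuousOn_setIntegral_slice hb (F := ρ₂) (cρ₂.mono hJs)
  have cr : ContinuousOn (fun t => D₃ * (∫ x in Ω, ρ₁ t x) + D₁ * ∫ x in Ω, ρ₂ t x) (Icc s t) :=
    (continuousOn_const.mul ci₁).add (continuousOn_const.mul ci₂)
  -- The production estimate integrates to `F' ≤ |C| |Ω| - F`, stated for increments of `F`.
  have hgr := le_gronwallBound_of_sub_le_integral (K := -1) (ε := |C| * volume.real Ω) cF cr
    (fun t₀ ht₀ t₁ ht₁ h01 => ?_) (fun τ hτ => ?_) (right_mem_Icc.2 hst)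
  · have hFs0 : 0 ≤ F s := by
      refine add_nonneg (mul_nonneg hD₃.le ?_) (mul_nonneg hD₁.le ?_)
      · exact setIntegral_nonneg hΩ.measurableSet fun x hx =>
          hH _ _ (hpos s hs x hx).1 (hpos s hs x hx).2.1
      · exact setIntegral_nonneg hΩ.measurableSet fun x hx =>
          hH _ _ (hpos s hs x hx).2.2.1 (hpos s hs x hx).2.2.2
    refine hgr.trans ((gronwallBound_neg_one_le hFs0 hCV (by linarith)).trans ?_)
    linarith [hsmall s ⟨hs.1, le_rfl⟩]
  · have hJ' : Icc t₀ t₁ ⊆ timeInterval T := (Icc_subset_Icc ht₀.1 ht₁.2).trans hJ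
    have hsub : Ioc t₀ t₁ ⊆ Icc s t := Ioc_subset_Icc_self.trans (Icc_subset_Icc ht₀.1 ht₁.2)
    have e1 := compartmentEnergy_sub_le hΩ hb h01 ha hb' hα hβ hD₁ hD₂ D (su.mono hJ')
      (sv.mono hJ') (fun t ht => hpos t (hJ' ht)) (fun t ht x hx => (hM t (hJ' ht) x hx).1) hDab
    have e2 := compartmentEnergy_sub_le hΩ hb h01 hc hd hα hβ hD₃ hD₄ D (sw.mono hJ')
      (sz.mono hJ') (fun t ht x hx => ⟨(hpos t (hJ' ht) x hx).2.2.1, (hpos t (hJ' ht) x hx).2.2.2,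
        (hpos t (hJ' ht) x hx).1, (hpos t (hJ' ht) x hx).2.1⟩)
      (fun t ht x hx => (hM t (hJ' ht) x hx).2) hDcd
    have i1 : IntegrableOn (fun t => ∫ x in Ω, ρ₁ t x) (Ioc t₀ t₁) :=
      (ci₁.integrableOn_Icc).mono_set hsub
    have i2 : IntegrableOn (fun t => ∫ x in Ω, ρ₂ t x) (Ioc t₀ t₁) :=
      (ci₂.integrableOn_Icc).mono_set hsub
    rw [integral_add (i1.const_mul D₃) (i2.const_mul D₁), integral_const_mul, integral_const_mul]
    have e1' := mul_le_mul_of_nonneg_left e1 hD₃.le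
    have e2' := mul_le_mul_of_nonneg_left e2 hD₁.le
    simp only [hF]
    linarith
  · have hτT := hJ hτ
    have j1 : IntegrableOn (ρ₁ τ) Ω :=
      integrableOn_of_continuousOn_closure hb (continuousOn_slice cρ₁ hτT)
    have j2 : IntegrableOn (ρ₂ τ) Ω :=
      integrableOn_of_continuousOn_closure hb (continuousOn_slice cρ₂ hτT)
    have j3 : IntegrableOn (fun x => D.H (u τ x) (v τ x)) Ω :=
      integrableOn_of_continuousOn_closure hb
        (continuousOn_slice (f := fun t x => D.H (u t x) (v t x)) cH₁ hτT)
    have j4 : IntegrableOn (fun x => D.H (w τ x) (z τ x)) Ω :=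
      integrableOn_of_continuousOn_closure hb
        (continuousOn_slice (f := fun t x => D.H (w t x) (z t x)) cH₂ hτT)
    have j5 : IntegrableOn (fun _ : Space N => C) Ω := integrableOn_const hb.measure_lt_top.ne
    have j6 : IntegrableOn (fun x => D₃ * D.H (u τ x) (v τ x) + D₁ * D.H (w τ x) (z τ x)) Ω :=
      (j3.const_mul D₃).add (j4.const_mul D₁)
    have hle := setIntegral_mono_on ((j1.const_mul D₃).add (j2.const_mul D₁))
      (j5.sub j6) hΩ.measurableSet fun x hx =>
        hC _ _ _ _ (hpos τ hτT x hx).1 (hpos τ hτT x hx).2.1 (hpos τ hτT x hx).2.2.1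
          (hpos τ hτT x hx).2.2.2 (hM τ hτT x hx).1 (hM τ hτT x hx).2
    simp only [Pi.add_apply, Pi.sub_apply] at hle
    rw [integral_add (j1.const_mul D₃) (j2.const_mul D₁),
      integral_sub j5 j6,
      integral_add (j3.const_mul D₃) (j4.const_mul D₁), integral_const_mul, integral_const_mul,
      integral_const_mul, integral_const_mul, setIntegral_const, smul_eq_mul] at hle
    have hCabs : volume.real Ω * C ≤ |C| * volume.real Ω := by
      rw [mul_comm]
      exact mul_le_mul_of_nonneg_right (le_abs_self C) hV
    simp only [hF, compartmentEnergy]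
    linarith
end

end Brusselator

/-! ### Choice of the constants and conclusion -/

theorem corollary1 {N : ℕ} (hN : 1 ≤ N)
    (Ω : Set (Brusselator.Space N)) (hΩ : Brusselator.IsBoundedC1Domain Ω)
    (a b c d α β D₁ D₂ D₃ D₄ : ℝ)
    (ha : 0 < a) (hb : 0 < b) (hc : 0 < c) (hd : 0 < d) (hα : 0 < α) (hβ : 0 < β)
    (hD₁ : 0 < D₁) (hD₂ : 0 < D₂) (hD₃ : 0 < D₃) (hD₄ : 0 < D₄)
    (u₀ v₀ w₀ z₀ : Brusselator.Space N → ℝ)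
    (hu₀ : MemLp u₀ ∞ (volume.restrict Ω)) (hv₀ : MemLp v₀ ∞ (volume.restrict Ω))
    (hw₀ : MemLp w₀ ∞ (volume.restrict Ω)) (hz₀ : MemLp z₀ ∞ (volume.restrict Ω))
    (hu₀_nonneg : ∀ᵐ x ∂(volume.restrict Ω), 0 ≤ u₀ x)
    (hv₀_nonneg : ∀ᵐ x ∂(volume.restrict Ω), 0 ≤ v₀ x)
    (hw₀_nonneg : ∀ᵐ x ∂(volume.restrict Ω), 0 ≤ w₀ x)
    (hz₀_nonneg : ∀ᵐ x ∂(volume.restrict Ω), 0 ≤ z₀ x)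
    (Tmax : EReal) (hTmax : 0 < Tmax)
    (u v w z : ℝ → Brusselator.Space N → ℝ)
    (hsol : Brusselator.IsSolution Ω a b c d α β D₁ D₂ D₃ D₄ u₀ v₀ w₀ z₀ Tmax u v w z) :
    ∀ (n : ℕ) [Fact (1 ≤ (n : ℝ≥0∞))],
      Brusselator.MemLinftyLp Ω Tmax n u ∧ Brusselator.MemLinftyLp Ω Tmax n v ∧
        Brusselator.MemLinftyLp Ω Tmax n w ∧ Brusselator.MemLinftyLp Ω Tmax n z := by
  intro n _
  have ho := hΩ.isOpen
  have hbd := hΩ.isBounded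
  have hpos : ∀ t ∈ Brusselator.timeInterval Tmax, ∀ x ∈ Ω,
      0 ≤ u t x ∧ 0 ≤ v t x ∧ 0 ≤ w t x ∧ 0 ≤ z t x := fun t ht =>
    hsol.nonneg ho hbd ha hb hc hd hα hβ hD₁ hD₂ hD₃ hD₄ hu₀_nonneg hv₀_nonneg hw₀_nonneg
      hz₀_nonneg hTmax ht
  obtain ⟨M, hM0, hM⟩ := hsol.exists_inhibitor_bound hN ho hbd hb hd hD₂ hD₄ hv₀ hz₀ hTmax
  set P : ℝ := ((n : ℝ) + 4) * (n + 3)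
  -- One `K` must serve both diffusivity pairs `(a, b)` and `(c, d)`, so that the same density can
  -- be used in both compartments; the sum of the two thresholds works.
  set K := (a + b) ^ 2 * P / (a * b) + (c + d) ^ 2 * P / (c * d) with hK
  have hab : 0 ≤ (a + b) ^ 2 * P / (a * b) := by positivity
  have hcd : 0 ≤ (c + d) ^ 2 * P / (c * d) := by positivity
  have hK0 : 0 ≤ K := add_nonneg hab hcd
  have hKab : (a + b) ^ 2 * P ≤ 2 * (a * b) * K := by
    have h1 : (a + b) ^ 2 * P / (a * b) ≤ 2 * K := by linarith
    rw [div_le_iff₀ (by positivity)] at h1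
    linarith
  have hKcd : (c + d) ^ 2 * P ≤ 2 * (c * d) * K := by
    have h1 : (c + d) ^ 2 * P / (c * d) ≤ 2 * K := by linarith
    rw [div_le_iff₀ (by positivity)] at h1
    linarith
  set A := 1 + 2 * K * ((n : ℝ) + 2) ^ 2 * (M + 1) ^ 2 with hAdef
  have hA : 2 * K * ((n : ℝ) + 2) ^ 2 * (M + 1) ^ 2 ≤ A := by linarith
  have hA1 : 1 ≤ A := by
    have : 0 ≤ 2 * K * ((n : ℝ) + 2) ^ 2 * (M + 1) ^ 2 := by positivity
    linarith
  set D := Brusselator.lyapunov n K A with hD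
  have hpow : ∀ r s y : ℝ, 0 ≤ r → 0 ≤ s → 0 ≤ y → y ≤ r + s → y ^ n ≤ D.H r s :=
    fun r s y hr hs hy hle => Brusselator.pow_le_lyapunov_H hK0 hA1 hr hs hy hle
  have hH : ∀ r s : ℝ, 0 ≤ r → 0 ≤ s → 0 ≤ D.H r s := fun r s hr hs =>
    (pow_nonneg hr n).trans (hpow r s r hr hs hr (by linarith))
  obtain ⟨B, hB⟩ := hsol.exists_energy_bound ho hbd ha hb hc hd hα hβ hD₁ hD₂ hD₃ hD₄ hTmax
    hpos hM D hH
    (fun r s hr hs hsM => Brusselator.lyapunov_dissipative ha hb hK0 hA1 hA hKab hr hs hsM)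
    (fun r s hr hs hsM => Brusselator.lyapunov_dissipative hc hd hK0 hA1 hA hKcd hr hs hsM)
    (Brusselator.exists_lyapunov_production_le hK0 hA1 hM0 hA hα hD₁ hD₂ hD₃ hD₄)
  have cu := hsol.comp_u.continuous_closure
  have cv := hsol.comp_v.continuous_closure
  have cw := hsol.comp_w.continuous_closure
  have cz := hsol.comp_z.continuous_closure
  have hE₁ : ∀ t ∈ Brusselator.timeInterval Tmax,
      0 ≤ Brusselator.compartmentEnergy Ω D u v t := fun t ht =>
    setIntegral_nonneg ho.measurableSet fun x hx =>
      hH _ _ (hpos t ht x hx).1 (hpos t ht x hx).2.1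
  have hE₂ : ∀ t ∈ Brusselator.timeInterval Tmax,
      0 ≤ Brusselator.compartmentEnergy Ω D w z t := fun t ht =>
    setIntegral_nonneg ho.measurableSet fun x hx =>
      hH _ _ (hpos t ht x hx).2.2.1 (hpos t ht x hx).2.2.2
  have hB₁ : ∀ t ∈ Brusselator.timeInterval Tmax,
      Brusselator.compartmentEnergy Ω D u v t ≤ B / D₃ := fun t ht => by
    rw [le_div_iff₀ hD₃]
    linarith [hB t ht, mul_nonneg hD₁.le (hE₂ t ht)]
  have hB₂ : ∀ t ∈ Brusselator.timeInterval Tmax,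
      Brusselator.compartmentEnergy Ω D w z t ≤ B / D₁ := fun t ht => by
    rw [le_div_iff₀ hD₁]
    linarith [hB t ht, mul_nonneg hD₃.le (hE₁ t ht)]
  -- Each component is nonnegative and at most the sum of the two species of its compartment, so the
  -- compartment energy bounds the integral of its `n`-th power.
  have hint : ∀ {q r s : ℝ → Brusselator.Space N → ℝ} {E : ℝ} {t : ℝ},
      t ∈ Brusselator.timeInterval Tmax →
      ContinuousOn (q t) (closure Ω) → ContinuousOn (r t) (closure Ω) →
      ContinuousOn (s t) (closure Ω) →
      (∀ x ∈ Ω, 0 ≤ r t x ∧ 0 ≤ s t x ∧ 0 ≤ q t x ∧ q t x ≤ r t x + s t x) →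
      Brusselator.compartmentEnergy Ω D r s t ≤ E → ∫ x in Ω, q t x ^ n ≤ E := by
    intro q r s E t ht hq hr hs hle hEn
    refine le_trans (setIntegral_mono_on
      (Brusselator.integrableOn_of_continuousOn_closure hbd (hq.pow n))
      (Brusselator.integrableOn_of_continuousOn_closure hbd
        (Brusselator.continuousOn_comp₂ D.continuous_H hr hs)) ho.measurableSet fun x hx => ?_) hEn
    obtain ⟨h1, h2, h3, h4⟩ := hle x hx
    exact hpow _ _ _ h1 h2 h3 h4
  refine ⟨?_, ?_, ?_, ?_⟩
  · refine Brusselator.memLinftyLp_of_integral_pow_le ho hbd n cu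
      (fun t ht x hx => (hpos t ht x hx).1) (B := B / D₃) fun t ht => ?_
    refine hint (r := u) (s := v) ht (Brusselator.continuousOn_slice cu ht)
      (Brusselator.continuousOn_slice cu ht) (Brusselator.continuousOn_slice cv ht)
      (fun x hx => ?_) (hB₁ t ht)
    obtain ⟨h1, h2, -, -⟩ := hpos t ht x hx
    exact ⟨h1, h2, h1, by linarith⟩
  · refine Brusselator.memLinftyLp_of_integral_pow_le ho hbd n cv
      (fun t ht x hx => (hpos t ht x hx).2.1) (B := B / D₃) fun t ht => ?_
    refine hint (r := u) (s := v) ht (Brusselator.continuousOn_slice cv ht)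
      (Brusselator.continuousOn_slice cu ht) (Brusselator.continuousOn_slice cv ht)
      (fun x hx => ?_) (hB₁ t ht)
    obtain ⟨h1, h2, -, -⟩ := hpos t ht x hx
    exact ⟨h1, h2, h2, by linarith⟩
  · refine Brusselator.memLinftyLp_of_integral_pow_le ho hbd n cw
      (fun t ht x hx => (hpos t ht x hx).2.2.1) (B := B / D₁) fun t ht => ?_
    refine hint (r := w) (s := z) ht (Brusselator.continuousOn_slice cw ht)
      (Brusselator.continuousOn_slice cw ht) (Brusselator.continuousOn_slice cz ht)
      (fun x hx => ?_) (hB₂ t ht)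
    obtain ⟨-, -, h1, h2⟩ := hpos t ht x hx
    exact ⟨h1, h2, h1, by linarith⟩
  · refine Brusselator.memLinftyLp_of_integral_pow_le ho hbd n cz
      (fun t ht x hx => (hpos t ht x hx).2.2.2) (B := B / D₁) fun t ht => ?_
    refine hint (r := w) (s := z) ht (Brusselator.continuousOn_slice cz ht)
      (Brusselator.continuousOn_slice cw ht) (Brusselator.continuousOn_slice cz ht)
      (fun x hx => ?_) (hB₂ t ht)
    obtain ⟨-, -, h1, h2⟩ := hpos t ht x hx
    exact ⟨h1, h2, h2, by linarith⟩
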